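/- Let $K$ be a field, $n\ge 1$, and let $Q$ be the linearly oriented quiver $1\to 2\to\cdots\to n$. Let $\operatorname{mod} KQ$ be the category of finite-dimensional right $KQ$-modules, i.e. of diagrams $V_1\leftarrow V_2\leftarrow\cdots\leftarrow V_n$ of finite-dimensional $K$-vector spaces, and $\mathcal D=D^b(\operatorname{mod} KQ)$. For $1\le i\le j\le n$ let $M_{ij}$ be the module with $V_k=K$ for $i\le k\le j$, $V_k=0$ otherwise, and identity maps between the nonzero spaces; put $S_i=M_{ii}$. A stability condition $\sigma=(Z,\mathcal P)$ on $\mathcal D$ is a Bridgeland stability condition (central charge $Z\colon K(\mathcal D)\to\mathbb C$ and slicing $\mathcal P$) satisfying the support property: there are a norm on $K(\mathcal D)\otimes\mathbb R$ and $C>0$ with $C\,|Z(E)|>\|[E]\|$ for every nonzero semistable $E$. An object is stable if it is a simple object of some $\mathcal P(\phi)$, and $\sigma$ is totally stable if every indecomposable object of $\mathcal D$ is stable. The group $\mathbb C$ acts on stability conditions by $s\cdot(Z,\mathcal P)=(e^{-\mathbf i\pi s}Z,\mathcal P_{\operatorname{Re}s})$ with $\mathcal P_x(\phi)=\mathcal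 P(\phi+x)$, and this action preserves total stability. Let $\operatorname{Poly}(n+1)$ be the set of strictly convex $(n+1)$-gons in $\mathbb C$ with vertices $P_0,P_1,\dots,P_n$ in anticlockwise order such that $P_0=0$ and $P_1=1$ (for $n=1$, the single degenerate polygon $(0,1)$). Then there is a bijection $\mathfrak Z$ from the set of totally stable stability conditions on $\mathcal D$ modulo $\mathbb C$ to $\operatorname{Poly}(n+1)$ such that, for every totally stable $\sigma=(Z,\mathcal P)$ with $\mathfrak Z([\sigma])=(P_0,\dots,P_n)$, $$Z(M_{ij})=Z(S_1)\,(P_j-P_{i-1})\qquad\text{for all }1\le i\le j\le n;$$ in particular $Z(M_{ij})=\overrightarrow{P_{i-1}P_j}$ for a representative normalized by $Z(S_1)=1$. Moreover the central charges of the indecomposable objects of $\mathcal D$ are exactly given by the oriented sides and diagonals: $$\{Z(E)\mid E\in\mathcal D\text{ indecomposable}\}=\{Z(S_1)\,(P_b-P_a)\mid 0\le a,b\le n,\ a\ne b\}.$$ -/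

import Mathlib

open CategoryTheory CategoryTheory.Limits CategoryTheory.Pretriangulated
open scoped TensorProduct

universe w v u

noncomputable section

section Triangulated

variable (D : Type u) [Category.{v} D] [HasZeroObject D] [HasShift D ℤ] [Preadditive D]
  [∀ n : ℤ, (shiftFunctor D n).Additive] [Pretriangulated D]

/-- The relations `[Y] = [X] + [Z]`, one for each distinguished triangle `X ⟶ Y ⟶ Z ⟶ X⟦1⟧`. -/
def grothendieckRelations : AddSubgroup (FreeAbelianGroup D) :=
  AddSubgroup.closure {x | ∃ T : Triangle D, T ∈ distTriang D ∧
    x = FreeAbelianGroup.of T.obj₂ - FreeAbelianGroup.of T.obj₁ - FreeAbelianGroup.of T.obj₃}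

/-- The Grothendieck group `K(D)` of a triangulated category. -/
abbrev GrothendieckK : Type u := FreeAbelianGroup D ⧸ grothendieckRelations D

variable {D}

/-- The class `[E]` of an object in the Grothendieck group. -/
def kClass (E : D) : GrothendieckK D :=
  QuotientAddGroup.mk (FreeAbelianGroup.of E)

variable (D)

/-- A Bridgeland stability condition with the support property. -/
@[ext]
structure StabilityCondition where
  /-- The central charge. -/
  Z : GrothendieckK D →+ ℂ
  /-- The slicing: a full (replete) subcategory for every real phase. -/
  P : ℝ → ObjectProperty D
  /-- Each slice is closed under isomorphisms. -/
  replete : ∀ φ, (P φ).IsClosedUnderIsomorphisms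
  /-- Each slice is an additive subcategory. -/
  additive : ∀ φ, (P φ).IsClosedUnderFiniteProducts
  /-- A nonzero object of `P φ` has central charge on the ray of phase `φ`. -/
  ray : ∀ (φ : ℝ) (E : D), P φ E → ¬ IsZero E →
    ∃ m : ℝ, 0 < m ∧ Z (kClass E) = m * Complex.exp (Complex.I * Real.pi * φ)
  /-- `P (φ + 1) = (P φ)[1]`; since both sides are replete and the shift is an equivalence,
  this says that `E⟦1⟧` lies in `P (φ + 1)` exactly when `E` lies in `P φ`. -/
  shift : ∀ (φ : ℝ) (E : D), P (φ + 1) (E⟦(1 : ℤ)⟧) ↔ P φ E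
  /-- No nonzero morphisms from higher to lower phases. -/
  hom_eq_zero : ∀ (φ₁ φ₂ : ℝ), φ₂ < φ₁ → ∀ (A₁ A₂ : D), P φ₁ A₁ → P φ₂ A₂ →
    ∀ f : A₁ ⟶ A₂, f = 0
  /-- Harder–Narasimhan filtrations: a tower `0 = E₀ ⟶ E₁ ⟶ ⋯ ⟶ E_l ≅ E` of distinguished
  triangles `E_i ⟶ E_{i+1} ⟶ A_i ⟶ E_i⟦1⟧` with `A_i` of strictly decreasing phases. -/
  hn : ∀ E : D, ¬ IsZero E → ∃ (l : ℕ) (φ : Fin l → ℝ) (F : Fin (l + 1) → D) (A : Fin l → D),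
    StrictAnti φ ∧ IsZero (F 0) ∧ Nonempty (F (Fin.last l) ≅ E) ∧
    ∀ i : Fin l, P (φ i) (A i) ∧
      ∃ (f : F i.castSucc ⟶ F i.succ) (g : F i.succ ⟶ A i) (h : A i ⟶ (F i.castSucc)⟦(1 : ℤ)⟧),
        Triangle.mk f g h ∈ distTriang D
  /-- The support property, for some norm `N` on `K(D) ⊗ ℝ`. -/
  support : ∃ N : Seminorm ℝ (ℝ ⊗[ℤ] GrothendieckK D), (∀ x, N x = 0 → x = 0) ∧
    ∃ C : ℝ, 0 < C ∧ ∀ (φ : ℝ) (E : D), P φ E → ¬ IsZero E →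
      N ((1 : ℝ) ⊗ₜ[ℤ] kClass E) < C * ‖Z (kClass E)‖

variable {D}

namespace StabilityCondition

/-- `E` is stable: it is a simple object of some slice `P φ`. -/
def IsStable (σ : StabilityCondition D) (E : D) : Prop :=
  ∃ (φ : ℝ) (h : σ.P φ E), Simple (⟨E, h⟩ : (σ.P φ).FullSubcategory)

/-- Every indecomposable object is stable. -/
def IsTotallyStable (σ : StabilityCondition D) : Prop :=
  ∀ E : D, Indecomposable E → σ.IsStable E

/-- The action `s · (Z, P) = (Z · e^{-iπs}, P_{Re s})`, where `P_x (φ) = P (φ + x)`. -/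
def translate (s : ℂ) (σ : StabilityCondition D) : StabilityCondition D where
  Z := (AddMonoidHom.mulRight (Complex.exp (-(Complex.I * Real.pi * s)))).comp σ.Z
  P φ := σ.P (φ + s.re)
  replete φ := σ.replete (φ + s.re)
  additive φ := σ.additive (φ + s.re)
  ray φ E hE h0 := by
    obtain ⟨m, hm, hZ⟩ := σ.ray _ E hE h0
    refine ⟨m * Real.exp (Real.pi * s.im), by positivity, ?_⟩
    simp only [AddMonoidHom.coe_comp, Function.comp_apply, AddMonoidHom.coe_mulRight, hZ,
      Complex.ofReal_mul, Complex.ofReal_exp, mul_assoc, ← Complex.exp_add]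
    congr 2
    apply Complex.ext
    · simp
    · simp
      ring
  shift φ E := by
    rw [show φ + 1 + s.re = (φ + s.re) + 1 by ring]
    exact σ.shift _ E
  hom_eq_zero φ₁ φ₂ h A₁ A₂ h₁ h₂ f :=
    σ.hom_eq_zero (φ₁ + s.re) (φ₂ + s.re) (by linarith) A₁ A₂ h₁ h₂ f
  hn E hE := by
    obtain ⟨l, φ, F, A, hφ, h0, hl, hA⟩ := σ.hn E hE
    refine ⟨l, fun i => φ i - s.re, F, A, fun i j hij => sub_lt_sub_right (hφ hij) _,
      h0, hl, fun i => ⟨?_, (hA i).2⟩⟩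
    simpa using (hA i).1
  support := by
    obtain ⟨N, hN, C, hC, h⟩ := σ.support
    refine ⟨N, hN, C * Real.exp (-(Real.pi * s.im)), by positivity, fun φ E hE h0 => ?_⟩
    refine (h _ E hE h0).trans_eq ?_
    have hnorm : ‖Complex.exp (-(Complex.I * Real.pi * s))‖ = Real.exp (Real.pi * s.im) := by
      rw [Complex.norm_exp]
      simp
    have hcancel : Real.exp (-(Real.pi * s.im)) * Real.exp (Real.pi * s.im) = 1 := by
      rw [← Real.exp_add]
      simp
    simp only [AddMonoidHom.coe_comp, Function.comp_apply, AddMonoidHom.coe_mulRight, norm_mul,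
      hnorm]
    linear_combination (-(C * ‖σ.Z (kClass E)‖)) * hcancel

lemma isTotallyStable_translate (s : ℂ) (σ : StabilityCondition D) (h : σ.IsTotallyStable) :
    (σ.translate s).IsTotallyStable := by
  intro E hE
  obtain ⟨φ, hφ, hs⟩ := h E hE
  obtain ⟨ψ, rfl⟩ : ∃ ψ, φ = ψ + s.re := ⟨φ - s.re, by ring⟩
  exact ⟨ψ, hφ, hs⟩

/-- The action of the additive group `ℂ` on stability conditions. -/
instance : AddAction ℂ (StabilityCondition D) where
  vadd := translate
  zero_vadd σ := by
    apply StabilityCondition.ext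
    · apply AddMonoidHom.ext
      intro x
      change σ.Z x * Complex.exp (-(Complex.I * Real.pi * 0)) = σ.Z x
      simp
    · funext φ
      change σ.P (φ + (0 : ℂ).re) = σ.P φ
      simp
  add_vadd s t σ := by
    apply StabilityCondition.ext
    · apply AddMonoidHom.ext
      intro x
      change σ.Z x * Complex.exp (-(Complex.I * Real.pi * (s + t))) =
        σ.Z x * Complex.exp (-(Complex.I * Real.pi * t)) *
          Complex.exp (-(Complex.I * Real.pi * s))
      rw [mul_assoc (σ.Z x), ← Complex.exp_add]
      congr 2
      ring
    · funext φ
      change σ.P (φ + (s + t).re) = σ.P (φ + s.re + t.re)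
      rw [Complex.add_re, add_assoc]

end StabilityCondition

variable (D)

/-- The totally stable stability conditions. -/
abbrev TotallyStable : Type _ := {σ : StabilityCondition D // σ.IsTotallyStable}

/-- The `ℂ`-action restricted to the totally stable stability conditions. -/
instance : AddAction ℂ (TotallyStable D) where
  vadd s σ := ⟨s +ᵥ σ.1, StabilityCondition.isTotallyStable_translate s σ.1 σ.2⟩
  zero_vadd σ := Subtype.ext (zero_vadd ℂ σ.1)
  add_vadd s t σ := Subtype.ext (add_vadd s t σ.1)

end Triangulated

section TypeA

/-- The vertices of the linearly oriented quiver `1 → 2 → ⋯ → n`; the vertex `k` of the quiver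
has index `k - 1` in `Fin n`. -/
structure LinearA (n : ℕ) : Type where
  /-- The index of the vertex. -/
  idx : Fin n

/-- There is exactly one arrow `k → k + 1`, and there are no other arrows. -/
instance (n : ℕ) : Quiver.{0} (LinearA n) where
  Hom a b := PLift (b.idx.val = a.idx.val + 1)

variable (K : Type u) [Field K] (n : ℕ)

/-- The category `mod K Q` of finite dimensional (right) modules over the path algebra of
`Q = (1 → 2 → ⋯ → n)`: finite dimensional representations of the opposite quiver, that is,
diagrams of vector spaces `V₁ ← V₂ ← ⋯ ← V_n`. -/
abbrev ModA : Type (u + 1) := Paths (LinearA n)ᵒᵖ ⥤ FGModuleCat.{u} K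

variable {n}

/-- The linear map `K^p → K^q` between copies of `K` or `0` (according to the truth of `p` and `q`)
that is the identity if `p` and `q` hold, and zero otherwise. -/
def stepMap (p q : Prop) : (PLift p → K) →ₗ[K] (PLift q → K) :=
  open Classical in
  if h : p then LinearMap.pi fun _ => LinearMap.proj ⟨h⟩ else 0

/-- The interval module `M_{ij}`: the vector space at `k` is `K` if `i ≤ k ≤ j` and `0` otherwise,
and the maps between nonzero spaces are identities. -/
def intervalModule (i j : Fin n) : ModA K n :=
  Paths.lift (V := (LinearA n)ᵒᵖ)
    { obj := fun k => FGModuleCat.of K (PLift (i ≤ k.unop.idx ∧ k.unop.idx ≤ j) → K)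
      map := fun {k l} _ => FGModuleCat.ofHom
        (stepMap K (i ≤ k.unop.idx ∧ k.unop.idx ≤ j)
          (i ≤ l.unop.idx ∧ l.unop.idx ≤ j)) }

variable [HasDerivedCategory.{w} (ModA K n)]

variable (n) in
/-- The bounded derived category `D^b(K Q)`. -/
abbrev DbA : Type (u + 1) := DerivedCategory.Bounded (ModA K n)

/-- The interval module `M_{ij}`, as a complex concentrated in degree `0`. -/
def MA (i j : Fin n) : DbA K n :=
  ⟨(DerivedCategory.singleFunctor (ModA K n) 0).obj (intervalModule K i j),
    ⟨⟨0, inferInstance⟩, ⟨0, inferInstance⟩⟩⟩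

end TypeA

/-- The convex `m`-gons in `ℂ` with vertices `P₀, …, P_{m-1}` in anticlockwise order such
that `P₀ = 0` and `P₁ = 1`. The points are the vertices of a convex polygon in anticlockwise order
exactly when each of the triangles `P_a P_b P_c` with `a < b < c` is nondegenerate and positively
oriented, i.e. `Im (conj (P_b - P_a) * (P_c - P_a)) > 0`. -/
def ConvexPoly (m : ℕ) [NeZero m] : Type :=
  {P : Fin m → ℂ // P 0 = 0 ∧ P 1 = 1 ∧
    ∀ a b c : Fin m, a < b → b < c → 0 < ((starRingEnd ℂ (P b - P a)) * (P c - P a)).im}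

end

/-! A pair `a < b` in `{0, …, n}` is a chord of an `(n + 1)`-gon, and it carries the module `M a b`
supported on the vertices `a + 1, …, b`. For `a < b < c` the short exact sequence of interval
modules gives a distinguished triangle `M a b ⟶ M a c ⟶ M b c ⟶`. Representations are sums of
interval modules and `KQ` is hereditary, so every object of the bounded derived category is a finite
sum of shifts of chord objects. These facts, together with the morphisms between shifted chord
objects and the dimension functionals on the Grothendieck group, are collected in `IsTypeA`; the
rest uses nothing else.

From stability to polygons: in a triangle of indecomposables no morphism vanishes, and if all three
are stable this forces the phases to increase strictly (`phase_lt_of_triangle`). Rotating gives `φ a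
b < φ a c < φ b c < φ a b + 1` (`exists_chordPhases`). As `Z (M a b) = p b - p a`, these
inequalities make each triangle `p a, p b, p c` positively oriented, which is convexity.

Injectivity: the polygon determines the phases modulo two, and the inequalities then determine them
once `φ 0 1` is fixed (`ChordPhases.eq`). The phases of the chord objects determine all slices
(`prop_le`), and the action of `ℂ` adjusts `φ 0 1` and `Z (M 0 1)` (`exists_vadd_eq`).

Surjectivity: a convex polygon has chord phases with the same inequalities
(`chordPhases_of_convexSeq`). Let `P ψ` consist of the sums of shifted chord objects of phase `ψ`.
Nonzero morphisms between shifted chord objects do not lower the phase and keep it only when source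
and target coincide (`phase_le_of_hom`). So grouping summands by phase is a Harder–Narasimhan
filtration and every shifted chord object is stable. The support property holds because there are
finitely many chords up to shift. -/

noncomputable section

/-! ### Representations of the linear quiver and morphisms of interval modules -/

section Representations

namespace LinearA

variable {n : ℕ}

/-- The position of a vertex of the path category. -/
def pos (a : Paths (LinearA n)ᵒᵖ) : Fin n := a.unop.idx

/-- The vertex at a given position. -/
def vtx (k : Fin n) : Paths (LinearA n)ᵒᵖ := Opposite.op ⟨k⟩

@[simp] lemma pos_vtx (k : Fin n) : pos (vtx k) = k := rfl

lemma pos_of_arrow {a b : (LinearA n)ᵒᵖ} (e : a ⟶ b) : a.unop.idx.val = b.unop.idx.val + 1 :=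
  e.unop.down

lemma pos_of_path {a b : (LinearA n)ᵒᵖ} (p : Quiver.Path a b) :
    a.unop.idx.val = b.unop.idx.val + p.length := by
  induction p with
  | nil => simp
  | cons p e ih =>
    have := pos_of_arrow e
    simp only [Quiver.Path.length_cons]
    omega

lemma pos_le {a b : Paths (LinearA n)ᵒᵖ} (f : a ⟶ b) : pos b ≤ pos a := by
  have := pos_of_path f
  exact Fin.le_def.2 (by unfold pos; omega)

/-- An arrow lowers the position by exactly one and a vertex is determined by its position, so a
path has no choice at any step. The path category is thus a preorder, and arbitrary choices of paths
below are harmless. -/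
lemma path_eq {a b : (LinearA n)ᵒᵖ} (p q : Quiver.Path a b) : p = q := by
  induction p with
  | nil =>
    cases q with
    | nil => rfl
    | cons q e =>
      have h1 := pos_of_arrow e
      have h2 := pos_of_path q
      omega
  | cons p e ih =>
    cases q with
    | nil =>
      have h1 := pos_of_arrow e
      have h2 := pos_of_path p
      omega
    | @cons c _ q e' =>
      have h1 := pos_of_arrow e
      have h2 := pos_of_arrow e'
      rename_i b' c'
      obtain ⟨⟨b'⟩⟩ := b'
      obtain ⟨⟨c⟩⟩ := c
      obtain rfl : b' = c := Fin.ext (by simp only at h1 h2; omega)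
      have he : e = e' := by
        obtain ⟨⟨_⟩⟩ := e
        obtain ⟨⟨_⟩⟩ := e'
        rfl
      rw [ih q, he]

instance (a b : Paths (LinearA n)ᵒᵖ) : Subsingleton (a ⟶ b) := ⟨path_eq⟩

lemma nonempty_hom {a b : Paths (LinearA n)ᵒᵖ} (h : pos b ≤ pos a) : Nonempty (a ⟶ b) := by
  obtain ⟨d, hd⟩ := Nat.exists_eq_add_of_le (Fin.le_def.1 h)
  induction d generalizing a with
  | zero =>
    obtain ⟨⟨a⟩⟩ := a
    obtain ⟨⟨b⟩⟩ := b
    obtain rfl : a = b := Fin.ext (by simpa [pos] using hd)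
    exact ⟨Quiver.Path.nil⟩
  | succ d ih =>
    have hlt : b.unop.idx.val + d < n := by
      have := a.unop.idx.2
      unfold pos at hd
      omega
    obtain ⟨p⟩ := ih (a := vtx ⟨b.unop.idx.val + d, hlt⟩)
      (Fin.le_def.2 (by simp [pos, vtx])) (by simp [pos, vtx])
    let e : (show (LinearA n)ᵒᵖ from a) ⟶ vtx ⟨b.unop.idx.val + d, hlt⟩ :=
      Quiver.Hom.op (V := LinearA n) ⟨by
        unfold pos at hd
        omega⟩
    exact ⟨e.toPath.comp p⟩

end LinearA

open LinearA

namespace ModA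

variable {K : Type u} [Field K] {n : ℕ}

/-- The vector space of a representation at a vertex. -/
abbrev space (V : ModA K n) (a : Paths (LinearA n)ᵒᵖ) : Type u := (V.obj a).obj

/-- The linear map of a representation along a path. -/
def trans (V : ModA K n) {a b : Paths (LinearA n)ᵒᵖ} (f : a ⟶ b) : space V a →ₗ[K] space V b :=
  (V.map f).hom.hom

/-- The component of a morphism of representations. -/
def comp {V W : ModA K n} (η : V ⟶ W) (a : Paths (LinearA n)ᵒᵖ) : space V a →ₗ[K] space W a :=
  (η.app a).hom.hom

lemma trans_trans (V : ModA K n) {a b c : Paths (LinearA n)ᵒᵖ} (f : a ⟶ b) (g : b ⟶ c)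
    (h : a ⟶ c) (x : space V a) : trans V g (trans V f x) = trans V h x := by
  rw [Subsingleton.elim h (f ≫ g)]
  simp [trans]

lemma trans_self (V : ModA K n) {a : Paths (LinearA n)ᵒᵖ} (f : a ⟶ a)
    (x : space V a) : trans V f x = x := by
  rw [Subsingleton.elim f (𝟙 a)]
  simp [trans]

lemma comp_trans {V W : ModA K n} (η : V ⟶ W) {a b : Paths (LinearA n)ᵒᵖ} (f : a ⟶ b)
    (x : space V a) : comp η b (trans V f x) = trans W f (comp η a x) := by
  exact congrArg (fun φ => φ.hom.hom x) (η.naturality f)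

@[simp] lemma comp_comp {V W U : ModA K n} (η : V ⟶ W) (θ : W ⟶ U) (a : Paths (LinearA n)ᵒᵖ)
    (x : space V a) : comp (η ≫ θ) a x = comp θ a (comp η a x) := by
  simp [comp]

@[simp] lemma comp_id (V : ModA K n) (a : Paths (LinearA n)ᵒᵖ)
    (x : space V a) : comp (𝟙 V) a x = x := by
  simp [comp]

@[simp] lemma comp_zero (V W : ModA K n) (a : Paths (LinearA n)ᵒᵖ)
    (x : space V a) : comp (0 : V ⟶ W) a x = 0 := by
  simp [comp]

lemma hom_ext' {V W : ModA K n} {η θ : V ⟶ W} (h : ∀ a x, comp η a x = comp θ a x) : η = θ := by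
  ext a x
  exact h a x

/-- Construct a morphism of representations. -/
def mkHom {V W : ModA K n} (φ : ∀ a, space V a →ₗ[K] space W a)
    (h : ∀ (a b : Paths (LinearA n)ᵒᵖ) (f : a ⟶ b) (x : space V a),
      φ b (trans V f x) = trans W f (φ a x)) : V ⟶ W where
  app a := FGModuleCat.ofHom (φ a)
  naturality a b f := by
    ext x
    exact h a b f x

@[simp] lemma comp_mkHom {V W : ModA K n} (φ : ∀ a, space V a →ₗ[K] space W a)
    (h : ∀ (a b : Paths (LinearA n)ᵒᵖ) (f : a ⟶ b) (x : space V a),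
      φ b (trans V f x) = trans W f (φ a x)) (a) (x : space V a) : comp (mkHom φ h) a x = φ a x := rfl

/-- The vertex lies in the interval. -/
def Mem (i j : Fin n) (a : Paths (LinearA n)ᵒᵖ) : Prop := i ≤ pos a ∧ pos a ≤ j

end ModA

variable (K : Type u) [Field K]

lemma stepMap_apply {p q : Prop} (hp : p) (x : PLift p → K) (y : PLift q) :
    stepMap K p q x y = x ⟨hp⟩ := by
  simp [stepMap, hp]

namespace ModA

variable {K} {n : ℕ}

/-- The identification of the space of an interval module at a vertex. -/
def intervalEquiv (i j : Fin n) (a : Paths (LinearA n)ᵒᵖ) :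
    space (intervalModule K i j) a ≃ₗ[K] (PLift (Mem i j a) → K) :=
  LinearEquiv.refl K _

lemma intervalEquiv_trans_arrow (i j : Fin n) {a b : (LinearA n)ᵒᵖ} (e : a ⟶ b)
    (x : space (intervalModule K i j) ((Paths.of _).obj a)) :
    intervalEquiv i j ((Paths.of _).obj b)
      (trans (intervalModule K i j) ((Paths.of _).map e) x) =
      stepMap K (Mem i j ((Paths.of _).obj a)) (Mem i j ((Paths.of _).obj b))
        (intervalEquiv i j _ x) := by
  have : (intervalModule K i j).map ((Paths.of _).map e) = FGModuleCat.ofHom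
        (stepMap K (Mem i j ((Paths.of _).obj a)) (Mem i j ((Paths.of _).obj b))) :=
    Paths.lift_toPath _ e
  unfold trans
  rw [this]
  rfl

lemma intervalEquiv_trans (i j : Fin n) {a b : Paths (LinearA n)ᵒᵖ} (f : a ⟶ b)
    (x : space (intervalModule K i j) a) (ha : Mem i j a) (hb : Mem i j b) :
    intervalEquiv i j b (trans (intervalModule K i j) f x) ⟨hb⟩ = intervalEquiv i j a x ⟨ha⟩ := by
  induction f using Paths.induction_fixed_source with
  | id => rw [trans_self]
  | comp f e ih =>
    have hu : Mem i j ((Paths.of _).obj _) :=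
      ⟨hb.1.trans (pos_le ((Paths.of _).map e)), (pos_le f).trans ha.2⟩
    have hm := ih hu
    rw [← trans_trans _ f ((Paths.of _).map e), intervalEquiv_trans_arrow,
      stepMap_apply K hu, hm]

/-- The coordinate on an interval module at a vertex. -/
def coord (i j : Fin n) (a : Paths (LinearA n)ᵒᵖ) : space (intervalModule K i j) a →ₗ[K] K :=
  open Classical in
  if h : Mem i j a then (LinearMap.proj (⟨h⟩ : PLift (Mem i j a))).comp
    (intervalEquiv i j a).toLinearMap else 0

/-- The generator of an interval module at a vertex. -/
def gen (K : Type u) [Field K] (i j : Fin n) (a : Paths (LinearA n)ᵒᵖ) :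
    space (intervalModule K i j) a :=
  (intervalEquiv i j a).symm fun _ => 1

lemma coord_apply {i j : Fin n} {a : Paths (LinearA n)ᵒᵖ} (h : Mem i j a)
    (x : space (intervalModule K i j) a) : coord i j a x = intervalEquiv i j a x ⟨h⟩ := by
  simp [coord, h]

lemma coord_gen {i j : Fin n} {a : Paths (LinearA n)ᵒᵖ} (h : Mem i j a) :
    coord i j a (gen K i j a) = 1 := by
  simp [coord_apply h, gen]

lemma interval_ext {i j : Fin n} {a : Paths (LinearA n)ᵒᵖ}
    {x y : space (intervalModule K i j) a} (h : Mem i j a → coord i j a x = coord i j a y) :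
    x = y := by
  apply (intervalEquiv i j a).injective
  funext ⟨ha⟩
  rw [← coord_apply, ← coord_apply, h ha]

lemma interval_eq_zero {i j : Fin n} {a : Paths (LinearA n)ᵒᵖ} (h : ¬ Mem i j a)
    (x : space (intervalModule K i j) a) : x = 0 :=
  interval_ext fun h' => absurd h' h

lemma eq_coord_smul_gen {i j : Fin n} {a : Paths (LinearA n)ᵒᵖ}
    (x : space (intervalModule K i j) a) : x = coord i j a x • gen K i j a :=
  interval_ext fun h => by simp [coord_gen h]

lemma coord_trans {i j : Fin n} {a b : Paths (LinearA n)ᵒᵖ} (f : a ⟶ b)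
    (x : space (intervalModule K i j) a) (ha : Mem i j a) (hb : Mem i j b) :
    coord i j b (trans _ f x) = coord i j a x := by
  rw [coord_apply ha, coord_apply hb, intervalEquiv_trans]

lemma trans_gen {i j : Fin n} {a b : Paths (LinearA n)ᵒᵖ} (f : a ⟶ b) (ha : Mem i j a) :
    trans _ f (gen K i j a) = gen K i j b :=
  interval_ext fun h => by rw [coord_trans f _ ha h, coord_gen ha, coord_gen h]

lemma gen_ne_zero {i j : Fin n} {a : Paths (LinearA n)ᵒᵖ} (h : Mem i j a) : gen K i j a ≠ 0 := by
  intro h0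
  have := coord_gen (K := K) h
  simp [h0] at this

lemma mem_top {i j : Fin n} (hij : i ≤ j) : Mem i j (vtx j) := ⟨hij, le_rfl⟩

/-- The morphism from an interval module determined by the image of the generator at the top
vertex. -/
def ofElem {i j : Fin n} {V : ModA K n} (x : space V (vtx j))
    (hx : ∀ (a) (f : vtx j ⟶ a), pos a < i → trans V f x = 0) : intervalModule K i j ⟶ V :=
  open Classical in
  mkHom (fun a => if h : Mem i j a then
      (LinearMap.toSpanSingleton K (space V a)
        (trans V (nonempty_hom (a := vtx j) (b := a) h.2).some x)).comp (coord i j a) else 0)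
    (by
      intro a b f y
      by_cases ha : Mem i j a
      · by_cases hb : Mem i j b
        · simp only [ha, hb, dif_pos, LinearMap.comp_apply, LinearMap.toSpanSingleton_apply,
            map_smul, coord_trans f y ha hb]
          rw [trans_trans]
        · simp only [ha, hb, dif_pos, dif_neg, LinearMap.comp_apply,
            LinearMap.toSpanSingleton_apply, map_smul, LinearMap.zero_apply, not_false_iff]
          rw [trans_trans V _ f ((nonempty_hom (a := vtx j) (b := a) ha.2).some ≫ f), hx, smul_zero]
          by_contra h
          exact hb ⟨not_lt.1 h, (pos_le f).trans ha.2⟩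
      · rw [interval_eq_zero ha y]
        simp)

lemma comp_ofElem_gen {i j : Fin n} (hij : i ≤ j) {V : ModA K n} (x : space V (vtx j))
    (hx : ∀ (a) (f : vtx j ⟶ a), pos a < i → trans V f x = 0) :
    comp (ofElem x hx) (vtx j) (gen K i j (vtx j)) = x := by
  have h : Mem i j (vtx j) := ⟨hij, le_rfl⟩
  refine (comp_mkHom _ _ _ _).trans ?_
  simp only [h, dif_pos, LinearMap.comp_apply,
    LinearMap.toSpanSingleton_apply, coord_gen h, one_smul, trans_self]

/-- The structure maps go from larger to smaller vertices, so `M_{ij}` is generated by its element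
at the top vertex `j`. -/
lemma hom_interval_ext {i j : Fin n} (hij : i ≤ j) {V : ModA K n} {η θ : intervalModule K i j ⟶ V}
    (h : comp η (vtx j) (gen K i j (vtx j)) = comp θ (vtx j) (gen K i j (vtx j))) : η = θ := by
  apply hom_ext'
  intro a x
  by_cases ha : Mem i j a
  · obtain ⟨f⟩ := nonempty_hom (a := vtx j) (b := a) ha.2
    rw [eq_coord_smul_gen x, map_smul, map_smul, ← trans_gen f (mem_top hij), comp_trans,
      comp_trans, h]
  · rw [interval_eq_zero ha x, map_zero, map_zero]

lemma trans_comp_gen_eq_zero {i j : Fin n} {V : ModA K n} (hij : i ≤ j)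
    (η : intervalModule K i j ⟶ V) {a : Paths (LinearA n)ᵒᵖ} (f : vtx j ⟶ a) (h : pos a < i) :
    trans V f (comp η (vtx j) (gen K i j (vtx j))) = 0 := by
  rw [← comp_trans, trans_gen f (mem_top hij), interval_eq_zero (fun h' => h.not_ge h'.1) (gen _ _ _ _),
    map_zero]

lemma interval_not_isZero {i j : Fin n} (hij : i ≤ j) : ¬ IsZero (intervalModule K i j) := by
  intro h
  have h1 := (IsZero.iff_id_eq_zero _).1 h
  have h2 := comp_id (intervalModule K i j) (vtx j) (gen K i j (vtx j))
  rw [h1, comp_zero] at h2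
  exact gen_ne_zero ⟨hij, le_rfl⟩ h2.symm

/-- A nonzero morphism between interval modules. -/
lemma le_of_hom_ne_zero {i j i' j' : Fin n} (hij : i ≤ j)
    (η : intervalModule K i j ⟶ intervalModule K i' j') (hη : η ≠ 0) :
    i ≤ i' ∧ i' ≤ j ∧ j ≤ j' := by
  have hx : comp η (vtx j) (gen K i j (vtx j)) ≠ 0 := fun h =>
    hη (hom_interval_ext hij (by rw [h, comp_zero]))
  have hm : Mem i' j' (vtx j) := by
    by_contra h
    exact hx (interval_eq_zero h _)
  refine ⟨?_, hm⟩
  by_contra! h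
  -- If `i' < i`, the image of the generator would survive down to the vertex `i'` in the target,
  -- although the generator itself dies there in the source.
  obtain ⟨f⟩ := nonempty_hom (a := vtx j) (b := vtx i') hm.1
  have h0 := trans_comp_gen_eq_zero hij η f h
  have hm' : Mem i' j' (vtx i') := ⟨le_rfl, hm.1.trans hm.2⟩
  have h1 := coord_trans f (comp η (vtx j) (gen K i j (vtx j))) hm hm'
  rw [h0, map_zero] at h1
  exact hx (interval_ext fun _ => by rw [map_zero, h1])

/-- The space at the top vertex is a line, so an endomorphism acts on the generator by a scalar; the
inverse scalar defines the inverse. -/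
lemma isIso_of_ne_zero {i j : Fin n} (hij : i ≤ j)
    (η : intervalModule K i j ⟶ intervalModule K i j) (hη : η ≠ 0) : IsIso η := by
  have hm : Mem i j (vtx j) := ⟨hij, le_rfl⟩
  set c := coord i j _ (comp η (vtx j) (gen K i j (vtx j))) with hc
  have hx : comp η (vtx j) (gen K i j (vtx j)) = c • gen K i j (vtx j) := eq_coord_smul_gen _
  have hc0 : c ≠ 0 := fun h =>
    hη (hom_interval_ext hij (by rw [hx, h, zero_smul, comp_zero]))
  let θ : intervalModule K i j ⟶ intervalModule K i j :=
    ofElem (c⁻¹ • gen K i j (vtx j)) (by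
      intro a f ha
      exact interval_eq_zero (fun h => ha.not_ge h.1) _)
  have hθ : comp θ (vtx j) (gen K i j (vtx j)) = c⁻¹ • gen K i j (vtx j) := comp_ofElem_gen hij _ _
  refine ⟨θ, hom_interval_ext hij ?_, hom_interval_ext hij ?_⟩
  · rw [comp_comp, hx, map_smul, hθ, smul_smul, mul_inv_cancel₀ hc0, one_smul, comp_id]
  · rw [comp_comp, hθ, map_smul, hx, smul_smul, inv_mul_cancel₀ hc0, one_smul, comp_id]

end ModA
end Representations

/-! ### Exactness, projectives, and decomposition into interval modules -/

section Representations
open LinearA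
namespace ModA

variable {K : Type u} [Field K] {n : ℕ}

variable (K) in
/-- Evaluation of representations at a vertex, as a functor to vector spaces. -/
def evalMod (a : Paths (LinearA n)ᵒᵖ) : ModA K n ⥤ ModuleCat.{u} K :=
  (evaluation _ _).obj a ⋙ forget₂ (FGModuleCat.{u} K) (ModuleCat.{u} K)

instance (a : Paths (LinearA n)ᵒᵖ) : (evalMod K a).Additive := by
  unfold evalMod; infer_instance
instance (a : Paths (LinearA n)ᵒᵖ) : PreservesFiniteLimits (evalMod K a) := by
  unfold evalMod; infer_instance
instance (a : Paths (LinearA n)ᵒᵖ) : PreservesFiniteColimits (evalMod K a) := by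
  unfold evalMod; infer_instance

lemma isZero_of_subsingleton {V : ModA K n} (h : ∀ a, Subsingleton (space V a)) : IsZero V :=
  (IsZero.iff_id_eq_zero _).2 (hom_ext' fun a _ => (h a).elim _ _)

/-- Evaluation at a vertex preserves finite limits and colimits, hence commutes with homology, and a
representation all of whose spaces vanish is zero. -/
lemma exact_of_comp {S : ShortComplex (ModA K n)}
    (h : ∀ a (x : space S.X₂ a), comp S.g a x = 0 → ∃ y, comp S.f a y = x) : S.Exact := by
  rw [ShortComplex.exact_iff_isZero_homology]
  apply isZero_of_subsingleton
  intro a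
  have h1 : (S.map (evalMod K a)).Exact := (ShortComplex.moduleCat_exact_iff _).2 (h a)
  rw [ShortComplex.exact_iff_isZero_homology] at h1
  exact ModuleCat.subsingleton_of_isZero (h1.of_iso (S.mapHomologyIso (evalMod K a)).symm)

lemma mono_of_comp {V W : ModA K n} (f : V ⟶ W) (h : ∀ a, Function.Injective (comp f a)) :
    Mono f :=
  ⟨fun η θ hh => hom_ext' fun a x => h a (by rw [← comp_comp, ← comp_comp, hh])⟩

lemma epi_of_comp {V W : ModA K n} (f : V ⟶ W) (h : ∀ a, Function.Surjective (comp f a)) :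
    Epi f :=
  ⟨fun η θ hh => hom_ext' fun a x => by
    obtain ⟨x, rfl⟩ := h a x
    rw [← comp_comp, ← comp_comp, hh]⟩

lemma comp_surjective {V W : ModA K n} (f : V ⟶ W) [Epi f] (a) : Function.Surjective (comp f a) :=
  (ModuleCat.epi_iff_surjective ((evalMod K a).map f)).1 inferInstance

lemma comp_injective {V W : ModA K n} (f : V ⟶ W) [Mono f] (a) : Function.Injective (comp f a) :=
  (ModuleCat.mono_iff_injective ((evalMod K a).map f)).1 inferInstance

lemma comp_ofElem {i j : Fin n} {V : ModA K n} (x : space V (vtx j))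
    (hx : ∀ (a) (f : vtx j ⟶ a), pos a < i → trans V f x = 0) {a : Paths (LinearA n)ᵒᵖ}
    (ha : Mem i j a) (f : vtx j ⟶ a) :
    comp (ofElem x hx) a (gen K i j a) = trans V f x := by
  have hij : i ≤ j := ha.1.trans ha.2
  rw [← trans_gen f (mem_top hij), comp_trans, comp_ofElem_gen hij]

/-- The interval modules starting at the first vertex are projective. -/
lemma projective_interval (i j : Fin n) (hi : i.val = 0) : Projective (intervalModule K i j) where
  factors {E X} f e _ := by
    have hij : i ≤ j := Fin.le_def.2 (by omega)
    obtain ⟨y, hy⟩ := comp_surjective e (vtx j) (comp f (vtx j) (gen K i j (vtx j)))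
    have hlt : ∀ a : Paths (LinearA n)ᵒᵖ, ¬ pos a < i := fun a h => by
      have := Fin.lt_def.1 h
      omega
    refine ⟨ofElem y fun a _ h => absurd h (hlt a), hom_interval_ext hij ?_⟩
    rw [comp_comp, comp_ofElem_gen hij, hy]

/-- The inclusion `M_{ik} ⟶ M_{ij}`. -/
def intervalIncl (K : Type u) [Field K] (i k j : Fin n) :
    intervalModule K i k ⟶ intervalModule K i j :=
  ofElem (gen K i j (vtx k)) fun _ _ h => interval_eq_zero (fun h' => h.not_ge h'.1) _

/-- The projection `M_{ij} ⟶ M_{lj}`. -/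
def intervalProj (K : Type u) [Field K] {i l : Fin n} (j : Fin n) (h : i ≤ l) :
    intervalModule K i j ⟶ intervalModule K l j :=
  ofElem (gen K l j (vtx j)) fun _ _ h' =>
    interval_eq_zero (fun h'' => h'.not_ge (h.trans h''.1)) _

lemma comp_intervalIncl {i k j : Fin n} (hkj : k ≤ j) {a : Paths (LinearA n)ᵒᵖ} (ha : Mem i k a) :
    comp (intervalIncl K i k j) a (gen K i k a) = gen K i j a := by
  obtain ⟨f⟩ := nonempty_hom (a := vtx k) (b := a) ha.2
  rw [intervalIncl, comp_ofElem _ _ ha f, trans_gen]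
  exact ⟨ha.1.trans ha.2, hkj⟩

lemma comp_intervalProj {i l j : Fin n} (hil : i ≤ l) (hlj : l ≤ j) {a : Paths (LinearA n)ᵒᵖ}
    (ha : Mem i j a) :
    comp (intervalProj K j hil) a (gen K i j a) = gen K l j a := by
  obtain ⟨f⟩ := nonempty_hom (a := vtx j) (b := a) ha.2
  rw [intervalProj, comp_ofElem _ _ ha f, trans_gen f (mem_top hlj)]

/-- The sequence `M_{ik} ⟶ M_{ij} ⟶ M_{lj}` where `l` is the successor of `k`. -/
def intervalSES (K : Type u) [Field K] {i k l j : Fin n} (hik : i ≤ k) (hkl : k.val + 1 = l.val)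
    (hlj : l ≤ j) : ShortComplex (ModA K n) :=
  ShortComplex.mk (intervalIncl K i k j)
    (intervalProj K j (l := l) (hik.trans (Fin.le_def.2 (by omega)))) (by
      have hkj : k ≤ j := Fin.le_def.2 (by have := Fin.le_def.1 hlj; omega)
      apply hom_interval_ext hik
      rw [comp_comp, comp_zero, comp_intervalIncl hkj (mem_top hik), comp_intervalProj _ hlj
        (show Mem i j (vtx k) from ⟨hik, hkj⟩)]
      exact interval_eq_zero (fun h => by have := Fin.le_def.1 h.1; simp at this; omega) _)

/-- With `i` the first vertex this is a projective resolution of `M_{lj}` of length one; general `i`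
yields the distinguished triangles attached to the triangles of the polygon. -/
lemma intervalSES_shortExact {i k l j : Fin n} (hik : i ≤ k) (hkl : k.val + 1 = l.val)
    (hlj : l ≤ j) : (intervalSES K hik hkl hlj).ShortExact := by
  have hkj : k ≤ j := Fin.le_def.2 (by have := Fin.le_def.1 hlj; omega)
  have hil : i ≤ l := hik.trans (Fin.le_def.2 (by omega))
  refine { exact := exact_of_comp ?_, mono_f := mono_of_comp _ ?_, epi_g := epi_of_comp _ ?_ }
  · intro a x hx
    change comp (intervalProj K j hil) a x = 0 at hx
    change space (intervalModule K i j) a at x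
    change ∃ y, comp (intervalIncl K i k j) a y = x
    by_cases ha : Mem i j a
    · by_cases hak : pos a ≤ k
      · refine ⟨coord i j a x • gen K i k a, ?_⟩
        rw [map_smul, comp_intervalIncl hkj ⟨ha.1, hak⟩, ← eq_coord_smul_gen]
      · refine ⟨0, ?_⟩
        have hla : Mem l j a := ⟨Fin.le_def.2 (by
          rw [not_le, Fin.lt_def] at hak; omega), ha.2⟩
        rw [eq_coord_smul_gen x, map_smul, comp_intervalProj hil hlj ha] at hx
        rw [eq_coord_smul_gen x, (smul_eq_zero.1 hx).resolve_right (gen_ne_zero hla), zero_smul,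
          map_zero]
    · exact ⟨0, by rw [interval_eq_zero ha x, map_zero]⟩
  · intro a
    change Function.Injective (comp (intervalIncl K i k j) a)
    rw [injective_iff_map_eq_zero]
    intro x hx
    by_cases ha : Mem i k a
    · rw [eq_coord_smul_gen x, map_smul, comp_intervalIncl hkj ha] at hx
      rw [eq_coord_smul_gen x,
        (smul_eq_zero.1 hx).resolve_right (gen_ne_zero ⟨ha.1, ha.2.trans hkj⟩), zero_smul]
    · exact interval_eq_zero ha x
  · intro a x
    change space (intervalModule K l j) a at x
    change ∃ y, comp (intervalProj K j hil) a y = x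
    by_cases ha : Mem l j a
    · exact ⟨coord l j a x • gen K i j a, by
        rw [map_smul, comp_intervalProj hil hlj ⟨hil.trans ha.1, ha.2⟩, ← eq_coord_smul_gen]⟩
    · exact ⟨0, by rw [interval_eq_zero ha x, map_zero]⟩

/-- The morphism to an interval module determined by a linear form at the bottom vertex. -/
def toInterval {i j : Fin n} {V : ModA K n} (l : space V (vtx i) →ₗ[K] K)
    (hl : ∀ (a) (f : a ⟶ vtx i) (x : space V a), j < pos a → l (trans V f x) = 0) :
    V ⟶ intervalModule K i j :=
  open Classical in
  mkHom (fun a => if h : Mem i j a then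
      (LinearMap.toSpanSingleton K _ (gen K i j a)).comp
        (l.comp (trans V (nonempty_hom (a := a) (b := vtx i) h.1).some)) else 0)
    (by
      intro a b f y
      by_cases hb : Mem i j b
      · by_cases ha : Mem i j a
        · simp only [ha, hb, dif_pos, LinearMap.comp_apply, LinearMap.toSpanSingleton_apply,
            map_smul, trans_gen f ha]
          rw [trans_trans]
        · simp only [ha, hb, dif_pos, dif_neg, LinearMap.comp_apply,
            LinearMap.toSpanSingleton_apply, LinearMap.zero_apply, not_false_iff, map_zero]
          rw [trans_trans V f _ (f ≫ (nonempty_hom (a := b) (b := vtx i) hb.1).some), hl, zero_smul]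
          by_contra h
          exact ha ⟨hb.1.trans (pos_le f), not_lt.1 h⟩
      · exact interval_ext fun h => absurd h hb)

lemma comp_toInterval {i j : Fin n} {V : ModA K n} (l : space V (vtx i) →ₗ[K] K)
    (hl : ∀ (a) (f : a ⟶ vtx i) (x : space V a), j < pos a → l (trans V f x) = 0)
    {a : Paths (LinearA n)ᵒᵖ} (ha : Mem i j a) (f : a ⟶ vtx i) (x : space V a) :
    comp (toInterval l hl) a x = l (trans V f x) • gen K i j a := by
  refine (comp_mkHom _ _ _ _).trans ?_
  rw [Subsingleton.elim f (nonempty_hom (a := a) (b := vtx i) ha.1).some]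
  simp only [ha, dif_pos, LinearMap.comp_apply, LinearMap.toSpanSingleton_apply]

/-- A nonzero representation has an interval module as a direct summand. -/
lemma exists_retract {V : ModA K n} (hV : ¬ IsZero V) :
    ∃ (i j : Fin n) (_ : i ≤ j) (s : intervalModule K i j ⟶ V) (r : V ⟶ intervalModule K i j),
      s ≫ r = 𝟙 _ := by
  classical
  -- A longest path with nonzero structure map, from `j` down to `i`, carves out the summand. By
  -- maximality `x` dies below `i`, and everything coming from above `j` dies at `i`, so `x` and a
  -- linear form `l` at `i` extend to morphisms from and to `M_{ij}`.
  let Q : ℕ → Prop := fun m => ∃ (a b : Paths (LinearA n)ᵒᵖ) (f : a ⟶ b) (x : space V a),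
    (pos a).val = (pos b).val + m ∧ trans V f x ≠ 0
  have hQ0 : Q 0 := by
    by_contra h
    refine hV (isZero_of_subsingleton fun a => subsingleton_of_forall_eq 0 fun x => ?_)
    by_contra hx
    exact h ⟨a, a, 𝟙 a, x, rfl, by rwa [trans_self]⟩
  set m := Nat.findGreatest Q n
  obtain ⟨a, b, f, x, hab, hx⟩ : Q m := Nat.findGreatest_spec (Nat.zero_le n) hQ0
  have hmax : ∀ (a' : Paths (LinearA n)ᵒᵖ) (g : a' ⟶ b) (y : space V a'), pos a < pos a' →
      trans V g y = 0 := by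
    intro a' g y hlt
    by_contra hy
    have hle := Fin.le_def.1 (pos_le g)
    rw [Fin.lt_def] at hlt
    have h1 := Nat.le_findGreatest (P := Q) (n := n) (m := (pos a').val - (pos b).val)
      (by omega) ⟨a', b, g, y, by omega, hy⟩
    change _ ≤ m at h1
    omega
  obtain ⟨l, hl⟩ : ∃ l : space V b →ₗ[K] K, l (trans V f x) = 1 :=
    Module.Projective.exists_dual_eq_one K hx
  obtain ⟨i, rfl⟩ : ∃ i, b = vtx i := ⟨pos b, rfl⟩
  obtain ⟨j, rfl⟩ : ∃ j, a = vtx j := ⟨pos a, rfl⟩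
  have hij : i ≤ j := pos_le f
  let s : intervalModule K (i) (j) ⟶ V := ofElem x (by
    intro c g hc
    by_contra h0
    have := Nat.le_findGreatest (P := Q) (n := n) (m := j.val - (pos c).val)
      (by omega) ⟨vtx j, c, g, x, by have := Fin.le_def.1 (pos_le g); simp only [pos_vtx] at this ⊢; omega, h0⟩
    change _ ≤ m at this
    have h2 := Fin.lt_def.1 hc
    simp only [pos_vtx] at hab
    omega)
  let r : V ⟶ intervalModule K (i) (j) :=
    toInterval l fun c g y hc => by rw [hmax c g y hc, map_zero]
  refine ⟨i, j, hij, s, r, hom_interval_ext hij ?_⟩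
  have h1 : comp s (vtx j) (gen K _ _ _) = x := comp_ofElem_gen hij _ _
  have h2 : comp r (vtx j) x = l (trans V f x) • gen K _ _ _ :=
    comp_toInterval l _ (mem_top hij) f x
  rw [comp_comp, comp_id, h1, h2, hl, one_smul]

/-- The total dimension of a representation. -/
def totalDim (V : ModA K n) : ℕ := ∑ k : Fin n, Module.finrank K (space V (vtx k))

instance (V : ModA K n) (a) : Module.Finite K (space V a) :=
  inferInstanceAs (Module.Finite K (V.obj a))

lemma totalDim_lt {V W : ModA K n} (f : V ⟶ W) [Mono f] (a : Paths (LinearA n)ᵒᵖ)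
    (y : space W a) (hy : ∀ x, comp f a x ≠ y) : totalDim V < totalDim W := by
  refine Finset.sum_lt_sum (fun k _ =>
    LinearMap.finrank_le_finrank_of_injective (comp_injective f _)) ⟨pos a, Finset.mem_univ _, ?_⟩
  rw [← LinearMap.finrank_range_of_inj (comp_injective f _)]
  refine Submodule.finrank_lt fun h => ?_
  have hmem : y ∈ LinearMap.range (comp f (vtx (pos a))) := by rw [h]; trivial
  obtain ⟨x, hx⟩ := hmem
  exact hy x hx

/-- Every representation is a finite direct sum of interval modules, as an induction principle. -/
theorem induction_on (Q : ModA K n → Prop) (zero : ∀ V, IsZero V → Q V)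
    (add : ∀ (V W : ModA K n) (i j : Fin n), i ≤ j → Q W →
      Nonempty (V ≅ intervalModule K i j ⊞ W) → Q V) (V : ModA K n) : Q V := by
  induction h : totalDim V using Nat.strong_induction_on generalizing V with
  | _ d ih =>
    by_cases hV : IsZero V
    · exact zero V hV
    · obtain ⟨i, j, hij, s, r, hsr⟩ := exists_retract hV
      have hr : Epi r := ⟨fun f g hfg => by
        rw [← Category.id_comp f, ← Category.id_comp g, ← hsr, Category.assoc, hfg, Category.assoc]⟩
      let S : ShortComplex (ModA K n) := ShortComplex.mk (kernel.ι r) r (kernel.condition r)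
      have hS : S.Exact := ShortComplex.exact_of_f_is_kernel _ (kernelIsKernel r)
      let sp : S.Splitting := ShortComplex.Splitting.ofExactOfSection S hS s hsr inferInstance
      refine add V (kernel r) i j hij (ih _ ?_ _ rfl)
        ⟨sp.isoBinaryBiproduct ≪≫ biprod.braiding _ _⟩
      rw [← h]
      -- The induction descends because the image of the generator under the section is not in the
      -- kernel of `r`.
      refine totalDim_lt (kernel.ι r) (vtx j) (comp s _ (gen K i j _)) fun x hx => ?_
      have h1 := congrArg (comp r (vtx j)) hx
      rw [← comp_comp, ← comp_comp, kernel.condition, hsr, comp_zero, comp_id] at h1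
      exact gen_ne_zero (mem_top hij) h1.symm

end ModA
end Representations

/-! ### Finite direct sums of members of a family -/

section DirectSums

set_option linter.unusedSectionVars false

variable {ι : Type*} {D : Type*} [Category D] [Preadditive D] [HasZeroObject D]
  [HasBinaryBiproducts D]

open ZeroObject in
/-- The direct sum of a list of objects of a family. -/
def dsum (X : ι → D) : List ι → D
  | [] => 0
  | i :: L => X i ⊞ dsum X L

open ZeroObject in
lemma dsum_nil (X : ι → D) : IsZero (dsum X []) := isZero_zero D

/-- The direct sum of a nonempty list. -/
def dsumCons (X : ι → D) (i : ι) (L : List ι) : dsum X (i :: L) ≅ X i ⊞ dsum X L := Iso.refl _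

/-- Adding a zero object. -/
def biprodIsoOfIsZeroLeft {A B : D} (hA : IsZero A) : B ≅ A ⊞ B where
  hom := biprod.inr
  inv := biprod.snd
  inv_hom_id := by
    ext
    · exact hA.eq_of_src _ _
    · exact hA.eq_of_src _ _
    · exact hA.eq_of_tgt _ _
    · simp

/-- Adding a zero object. -/
def biprodIsoOfIsZeroRight {A B : D} (hB : IsZero B) : A ≅ A ⊞ B :=
  biprodIsoOfIsZeroLeft hB ≪≫ biprod.braiding _ _

lemma dsum_append (X : ι → D) (L L' : List ι) :
    Nonempty (dsum X (L ++ L') ≅ dsum X L ⊞ dsum X L') := by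
  induction L with
  | nil => exact ⟨biprodIsoOfIsZeroLeft (dsum_nil X)⟩
  | cons i L ih =>
    obtain ⟨e⟩ := ih
    exact ⟨biprod.mapIso (Iso.refl (X i)) e ≪≫ (biprod.associator _ _ _).symm⟩

lemma dsum_map {D' : Type*} [Category D'] [Preadditive D'] [HasZeroObject D']
    [HasBinaryBiproducts D'] (F : D ⥤ D') [F.Additive] {κ : Type*} {X : ι → D} {Y : κ → D'}
    {σ : ι → κ} (h : ∀ i, Nonempty (F.obj (X i) ≅ Y (σ i))) (L : List ι) :
    Nonempty (F.obj (dsum X L) ≅ dsum Y (L.map σ)) := by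
  induction L with
  | nil => exact ⟨(F.map_isZero (dsum_nil X)).iso (dsum_nil Y)⟩
  | cons i L ih =>
    obtain ⟨e⟩ := ih
    obtain ⟨e'⟩ := h i
    have := preservesBinaryBiproducts_of_preservesBiproducts F
    exact ⟨F.mapBiprod _ _ ≪≫ biprod.mapIso e' e⟩

lemma dsum_filter (X : ι → D) (p : ι → Bool) (L : List ι) :
    Nonempty (dsum X L ≅ dsum X (L.filter p) ⊞ dsum X (L.filter fun i => !p i)) := by
  induction L with
  | nil => exact ⟨biprodIsoOfIsZeroLeft (dsum_nil X)⟩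
  | cons i L ih =>
    obtain ⟨e⟩ := ih
    by_cases hi : p i
    · simp only [List.filter_cons, hi, if_true, Bool.not_true, if_false, Bool.false_eq_true]
      exact ⟨biprod.mapIso (Iso.refl (X i)) e ≪≫ (biprod.associator _ _ _).symm⟩
    · simp only [List.filter_cons, hi, if_false, Bool.not_false, if_true, Bool.false_eq_true]
      exact ⟨biprod.mapIso (Iso.refl (X i)) e ≪≫ biprod.braiding _ _ ≪≫
        biprod.associator _ _ _ ≪≫ biprod.mapIso (Iso.refl _) (biprod.braiding _ _)⟩

lemma dsum_hom_eq_zero {X : ι → D} {L : List ι} {A : D} (h : ∀ i ∈ L, ∀ f : A ⟶ X i, f = 0)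
    (f : A ⟶ dsum X L) : f = 0 := by
  induction L with
  | nil => exact (dsum_nil X).eq_of_tgt _ _
  | cons i L ih =>
    rw [← cancel_mono (dsumCons X i L).hom, zero_comp]
    ext
    · rw [h i (by simp) ((f ≫ _) ≫ biprod.fst), zero_comp]
    · rw [ih (fun j hj => h j (by simp [hj])) ((f ≫ _) ≫ biprod.snd), zero_comp]

lemma hom_dsum_eq_zero {X : ι → D} {L : List ι} {A : D} (h : ∀ i ∈ L, ∀ f : X i ⟶ A, f = 0)
    (f : dsum X L ⟶ A) : f = 0 := by
  induction L with
  | nil => exact (dsum_nil X).eq_of_src _ _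
  | cons i L ih =>
    rw [← cancel_epi (dsumCons X i L).inv, comp_zero]
    ext
    · rw [h i (by simp) (biprod.inl ≫ _), comp_zero]
    · rw [ih (fun j hj => h j (by simp [hj])) (biprod.inr ≫ _), comp_zero]

/-- A member of the list gives a direct summand of the direct sum. -/
lemma dsum_retract {X : ι → D} {L : List ι} {i : ι} (hi : i ∈ L) :
    ∃ (s : X i ⟶ dsum X L) (r : dsum X L ⟶ X i), s ≫ r = 𝟙 _ := by
  induction L with
  | nil => simp at hi
  | cons j L ih =>
    by_cases hij : i = j
    · subst hij
      exact ⟨biprod.inl ≫ (dsumCons X i L).inv, (dsumCons X i L).hom ≫ biprod.fst, by simp⟩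
    · obtain ⟨s, r, hsr⟩ := ih (by simpa [hij] using hi)
      exact ⟨s ≫ biprod.inr ≫ (dsumCons X j L).inv, (dsumCons X j L).hom ≫ biprod.snd ≫ r,
        by simp [hsr]⟩

/-- A morphism out of a direct sum is nonzero on some summand. -/
lemma exists_comp_ne_zero {X : ι → D} {L : List ι} {A : D} {f : dsum X L ⟶ A} (hf : f ≠ 0) :
    ∃ i ∈ L, ∃ s : X i ⟶ dsum X L, s ≫ f ≠ 0 := by
  by_contra! h
  refine hf ?_
  clear hf
  induction L with
  | nil => exact (dsum_nil X).eq_of_src _ _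
  | cons i L ih =>
    rw [← cancel_epi (dsumCons X i L).inv, comp_zero]
    ext
    · rw [comp_zero, ← Category.assoc]
      exact h i (by simp) _
    · rw [comp_zero]
      refine ih fun j hj s => ?_
      rw [← Category.assoc, ← Category.assoc]
      exact h j (by simp [hj]) _

/-- The object is isomorphic to a finite direct sum of members of the family. -/
def IsDSum (X : ι → D) (E : D) : Prop := ∃ L : List ι, Nonempty (E ≅ dsum X L)

lemma IsDSum.of_iso {X : ι → D} {E E' : D} (h : IsDSum X E) (e : E' ≅ E) : IsDSum X E' := by
  obtain ⟨L, ⟨e'⟩⟩ := h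
  exact ⟨L, ⟨e ≪≫ e'⟩⟩

lemma isDSum_of_isZero (X : ι → D) {E : D} (h : IsZero E) : IsDSum X E :=
  ⟨[], ⟨h.iso (dsum_nil X)⟩⟩

lemma isDSum_single (X : ι → D) (i : ι) : IsDSum X (X i) :=
  ⟨[i], ⟨biprodIsoOfIsZeroRight (dsum_nil X)⟩⟩

lemma IsDSum.biprod {X : ι → D} {E E' : D} (h : IsDSum X E) (h' : IsDSum X E') :
    IsDSum X (E ⊞ E') := by
  obtain ⟨L, ⟨e⟩⟩ := h
  obtain ⟨L', ⟨e'⟩⟩ := h'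
  exact ⟨L ++ L', ⟨biprod.mapIso e e' ≪≫ (dsum_append X L L').some.symm⟩⟩

/-- An indecomposable direct sum is isomorphic to one of the summands. -/
lemma IsDSum.of_indecomposable {X : ι → D} {E : D} (hE : IsDSum X E) (h : Indecomposable E) :
    ∃ i, Nonempty (E ≅ X i) := by
  obtain ⟨L, ⟨e⟩⟩ := hE
  induction L with
  | nil => exact absurd ((dsum_nil X).of_iso e) h.1
  | cons i L ih =>
    rcases h.2 _ _ e with h0 | h0
    · exact ih (e ≪≫ (biprodIsoOfIsZeroLeft h0).symm)
    · exact ⟨i, ⟨e ≪≫ (biprodIsoOfIsZeroRight h0).symm⟩⟩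

/-- A nonzero object all of whose nonzero endomorphisms are isomorphisms is indecomposable. -/
lemma indecomposable_of_isIso {E : D} (h0 : ¬ IsZero E) (h : ∀ f : E ⟶ E, f ≠ 0 → IsIso f) :
    Indecomposable E := by
  refine ⟨h0, fun Y Z e => ?_⟩
  let p : E ⟶ E := e.hom ≫ biprod.fst ≫ biprod.inl ≫ e.inv
  let q : E ⟶ E := e.hom ≫ biprod.snd ≫ biprod.inr ≫ e.inv
  have hpq : p ≫ q = 0 := by simp [p, q]
  by_cases hp : p = 0
  · left
    have : (biprod.inl ≫ e.inv) ≫ p ≫ (e.hom ≫ biprod.fst) = 𝟙 Y := by simp [p]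
    rw [hp, zero_comp, comp_zero] at this
    exact (IsZero.iff_id_eq_zero _).2 this.symm
  · right
    have := h p hp
    have hq : q = 0 := by rw [← cancel_epi p, hpq, comp_zero]
    have : (biprod.inr ≫ e.inv) ≫ q ≫ (e.hom ≫ biprod.snd) = 𝟙 Z := by simp [q]
    rw [hq, zero_comp, comp_zero] at this
    exact (IsZero.iff_id_eq_zero _).2 this.symm

end DirectSums

/-! ### Objects of the bounded derived category of a hereditary category split -/

section DerivedHereditary

open DerivedCategory DerivedCategory.TStructure

variable {C : Type u} [Category.{v} C] [Abelian C] [HasDerivedCategory.{w} C]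

lemma single_hom_eq_zero_of_neg (X Y : C) (k : ℤ) (hk : k < 0)
    (f : (singleFunctor C 0).obj X ⟶ ((singleFunctor C 0).obj Y)⟦k⟧) : f = 0 := by
  have : t.IsGE (((singleFunctor C 0).obj Y)⟦k⟧) (-k) := t.isGE_shift _ 0 k (-k)
  exact t.zero f 0 (-k)

lemma single_hom_eq_zero_of_projectiveDimension (X Y : C) (m : ℕ) [HasProjectiveDimensionLT X m]
    (k : ℤ) (hk : m ≤ k)
    (f : (singleFunctor C 0).obj X ⟶ ((singleFunctor C 0).obj Y)⟦k⟧) : f = 0 := by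
  have := hasExt_of_hasDerivedCategory C
  obtain ⟨l, rfl⟩ := Int.eq_ofNat_of_zero_le (show 0 ≤ k by omega)
  have h : Subsingleton (Abelian.Ext X Y l) :=
    HasProjectiveDimensionLT.subsingleton X m l (by exact_mod_cast hk) Y
  obtain ⟨α, rfl⟩ := Abelian.Ext.homEquiv.surjective f
  rw [Subsingleton.elim α 0]
  exact Abelian.Ext.zero_hom ..

variable (hC : ∀ X : C, HasProjectiveDimensionLT X 2)
include hC

/-- Dévissage along the truncation triangles of `Y` reduces to a single object in a degree at most
`-2`; there a morphism is an `Ext` class of degree at least two. -/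
lemma single_hom_eq_zero_of_isLE (X : C) (d : ℕ) (b : ℤ) (hb : b ≤ -2) (Y : DerivedCategory C)
    (hY : t.IsLE Y b) (hY' : t.IsGE Y (b - d)) (f : (singleFunctor C 0).obj X ⟶ Y) : f = 0 := by
  have base : ∀ (b : ℤ) (hb : b ≤ -2) (Y : DerivedCategory C)
    (hY : t.IsLE Y b) (hY' : t.IsGE Y b) (f : (singleFunctor C 0).obj X ⟶ Y), f = 0 := by
    intro b hb Y hY hY' f
    obtain ⟨V, ⟨e⟩⟩ := exists_iso_singleFunctor_obj_of_isGE_of_isLE Y b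
    let e' : (singleFunctor C b).obj V ≅ ((singleFunctor C 0).obj V)⟦-b⟧ :=
      (((singleFunctors C).shiftIso (-b) b 0 (by omega)).app V).symm
    have := hC X
    rw [← cancel_mono (e.hom ≫ e'.hom), zero_comp]
    exact single_hom_eq_zero_of_projectiveDimension X V 2 (-b) (by push_cast; omega) _
  induction d generalizing b Y with
  | zero => exact base b hb Y hY (by simpa using hY') f
  | succ d ih =>
    obtain ⟨A, B, hA, hB, g, h, k, hT⟩ := t.exists_triangle Y (b - 1) b (by omega)
    have hA1 : t.IsLE A (b - 1) := ⟨hA⟩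
    have hB1 : t.IsGE B b := ⟨hB⟩
    -- The lower bound of `A` is read off from `B⟦-1⟧ ⟶ A ⟶ Y`, the upper bound of `B` from `Y ⟶ B ⟶
    -- A⟦1⟧`.
    have hA2 : t.IsGE A (b - 1 - d) := by
      have : t.IsGE (B⟦(-1 : ℤ)⟧) (b + 1) := t.isGE_shift _ b (-1) (b + 1)
      have h1 : t.IsGE (B⟦(-1 : ℤ)⟧) (b - 1 - d) := t.isGE_of_ge _ _ (b + 1)
      exact t.isGE₂ _ (inv_rot_of_distTriang _ hT) _ h1
        (by push_cast at hY'; rwa [show b - 1 - (d : ℤ) = b - (d + 1) by ring])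
    have hB2 : t.IsLE B b := by
      have : t.IsLE (A⟦(1 : ℤ)⟧) (b - 2) := t.isLE_shift _ (b - 1) 1 (b - 2)
      have h1 : t.IsLE (A⟦(1 : ℤ)⟧) b := t.isLE_of_le _ (b - 2) _
      exact t.isLE₂ _ (rot_of_distTriang _ hT) _ hY h1
    obtain ⟨f', hf'⟩ := Triangle.coyoneda_exact₂ _ hT f (base b hb B hB2 hB1 (f ≫ h))
    rw [hf', ih (b - 1) (by omega) A hA1 hA2 f']
    exact zero_comp

/-- In the bounded derived category of a hereditary category, a property which holds for shifts
of objects of the heart and which is stable under direct sums holds for all objects. -/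
theorem hereditary_induction (Q : DerivedCategory C → Prop)
    (iso : ∀ {E E' : DerivedCategory C}, (E ≅ E') → Q E' → Q E)
    (single : ∀ (m : ℤ) (V : C), Q ((singleFunctor C m).obj V))
    (biprod : ∀ E E', Q E → Q E' → Q (E ⊞ E')) (E : DerivedCategory C) (hE : t.bounded E) :
    Q E := by
  -- Induction on the width `d` of the range `[b - d, b]` containing the cohomology; each step
  -- splits off the cohomology in the top degree.
  suffices ∀ (d : ℕ) (b : ℤ) (E : DerivedCategory C), t.IsLE E b → t.IsGE E (b - d) → Q E by
    obtain ⟨⟨a, ha⟩, ⟨b, hb⟩⟩ := hE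
    exact this (max a b - a).toNat (max a b) E (t.isLE_of_le _ b _ (le_max_right _ _))
      (by rwa [Int.toNat_of_nonneg (by simp), sub_sub_cancel])
  intro d
  induction d with
  | zero =>
    intro b E hE hE'
    have : t.IsGE E b := by simpa using hE'
    obtain ⟨V, ⟨e⟩⟩ := exists_iso_singleFunctor_obj_of_isGE_of_isLE E b
    exact iso e (single b V)
  | succ d ih =>
    intro b E hE hE'
    obtain ⟨A, B, hA, hB, g, h, k, hT⟩ := t.exists_triangle E (b - 1) b (by omega)
    have hA1 : t.IsLE A (b - 1) := ⟨hA⟩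
    have hB1 : t.IsGE B b := ⟨hB⟩
    have hA2 : t.IsGE A (b - 1 - d) := by
      have : t.IsGE (B⟦(-1 : ℤ)⟧) (b + 1) := t.isGE_shift _ b (-1) (b + 1)
      have h1 : t.IsGE (B⟦(-1 : ℤ)⟧) (b - 1 - d) := t.isGE_of_ge _ _ (b + 1)
      exact t.isGE₂ _ (inv_rot_of_distTriang _ hT) _ h1
        (by push_cast at hE'; rwa [show b - 1 - (d : ℤ) = b - (d + 1) by ring])
    have hB2 : t.IsLE B b := by
      have : t.IsLE (A⟦(1 : ℤ)⟧) (b - 2) := t.isLE_shift _ (b - 1) 1 (b - 2)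
      have h1 : t.IsLE (A⟦(1 : ℤ)⟧) b := t.isLE_of_le _ (b - 2) _
      exact t.isLE₂ _ (rot_of_distTriang _ hT) _ hE h1
    obtain ⟨V, ⟨e⟩⟩ := exists_iso_singleFunctor_obj_of_isGE_of_isLE B b
    -- `B` is concentrated in degree `b` and `A⟦1⟧` lives in degrees at most `b - 2`, so the
    -- connecting morphism vanishes by heredity and the truncation triangle splits.
    have hk : k = 0 := by
      apply (shiftFunctor (DerivedCategory C) b).map_injective
      let e' : (singleFunctor C 0).obj V ≅ ((singleFunctor C b).obj V)⟦b⟧ :=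
        (((singleFunctors C).shiftIso b 0 b (by omega)).app V).symm
      rw [Functor.map_zero, ← cancel_epi (e'.hom ≫ e.inv⟦b⟧'), comp_zero]
      have h1 : t.IsLE (A⟦(1 : ℤ)⟧) (b - 2) := t.isLE_shift _ (b - 1) 1 (b - 2)
      have h2 : t.IsGE (A⟦(1 : ℤ)⟧) (b - 2 - d) := t.isGE_shift _ (b - 1 - d) 1 (b - 2 - d)
      exact single_hom_eq_zero_of_isLE hC V d (-2) le_rfl _
        (t.isLE_shift _ (b - 2) b (-2)) (t.isGE_shift _ (b - 2 - d) b (-2 - d)) _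
    obtain ⟨e', -, -⟩ := exists_iso_binaryBiproduct_of_distTriang _ hT hk
    exact iso e' (biprod _ _ (ih (b - 1) A hA1 hA2) (iso e (single b V)))

end DerivedHereditary

/-! ### Shifted interval modules and the morphisms between them -/

section DerivedIntervals

open DerivedCategory DerivedCategory.TStructure LinearA ModA

variable {K : Type u} [Field K] {n : ℕ}

/-- Unless `i` is the first vertex `o`, where the module is projective, use the resolution `0 ⟶
M_{o,i-1} ⟶ M_{oj} ⟶ M_{ij} ⟶ 0` with projective terms. -/
lemma hasProjectiveDimensionLT_interval (i j : Fin n) (hij : i ≤ j) :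
    HasProjectiveDimensionLT (intervalModule K i j) 2 := by
  by_cases hi : i.val = 0
  · have := projective_interval (K := K) i j hi
    exact hasProjectiveDimensionLT_of_ge _ 1 2 (by norm_num)
  · have h0 : 0 < n := by have := i.2; omega
    let k : Fin n := ⟨i.val - 1, by omega⟩
    have h1 := projective_interval (K := K) ⟨0, h0⟩ k rfl
    have h2 := projective_interval (K := K) ⟨0, h0⟩ j rfl
    have h3 : HasProjectiveDimensionLT (intervalModule K ⟨0, h0⟩ k) 1 := inferInstance
    have h4 := hasProjectiveDimensionLT_of_ge (intervalModule K ⟨0, h0⟩ j) 1 2 (by norm_num)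
    exact (intervalSES_shortExact (K := K) (i := ⟨0, h0⟩) (k := k) (l := i) (j := j)
      (Fin.le_def.2 (Nat.zero_le _)) (by simp only [k]; omega)
      hij).hasProjectiveDimensionLT_X₃ 1 h3 h4

lemma hasProjectiveDimensionLT_two (V : ModA K n) : HasProjectiveDimensionLT V 2 := by
  induction V using ModA.induction_on with
  | zero V hV =>
    have := hV.hasProjectiveDimensionLT_zero
    exact hasProjectiveDimensionLT_of_ge _ 0 2 (by norm_num)
  | add V W i j hij hW e =>
    obtain ⟨e⟩ := e
    have := hasProjectiveDimensionLT_interval (K := K) i j hij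
    exact hasProjectiveDimensionLT_of_iso e.symm 2

variable [HasDerivedCategory.{w} (ModA K n)]

variable (K n) in
/-- Shifts of interval modules in the derived category. -/
def shiftedInterval (x : {x : Fin n × Fin n // x.1 ≤ x.2} × ℤ) : DerivedCategory (ModA K n) :=
  ((singleFunctor (ModA K n) 0).obj (intervalModule K x.1.1.1 x.1.1.2))⟦x.2⟧

lemma isDSum_single_obj (V : ModA K n) (m : ℤ) :
    IsDSum (shiftedInterval K n) ((singleFunctor (ModA K n) m).obj V) := by
  induction V using ModA.induction_on with
  | zero V hV => exact isDSum_of_isZero _ (Functor.map_isZero _ hV)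
  | add V W i j hij hW e =>
    obtain ⟨e⟩ := e
    have := preservesBinaryBiproducts_of_preservesBiproducts (singleFunctor (ModA K n) m)
    let e' : (singleFunctor (ModA K n) m).obj (intervalModule K i j) ≅
        shiftedInterval K n (⟨(i, j), hij⟩, -m) :=
      (((singleFunctors (ModA K n)).shiftIso (-m) m 0 (by omega)).app _).symm
    exact (((isDSum_single _ _).of_iso e').biprod hW).of_iso
      ((singleFunctor (ModA K n) m).mapIso e ≪≫ (singleFunctor (ModA K n) m).mapBiprod _ _)

/-- Every object of the bounded derived category is a finite direct sum of shifts of interval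
modules. -/
theorem isDSum_of_bounded (E : DerivedCategory (ModA K n)) (hE : t.bounded E) :
    IsDSum (shiftedInterval K n) E :=
  hereditary_induction hasProjectiveDimensionLT_two _ (fun e h => h.of_iso e)
    (fun m V => isDSum_single_obj V m) (fun _ _ h h' => h.biprod h') E hE

/-- The morphisms between shifted interval modules. -/
theorem interval_hom_cases {i j i' j' : Fin n} (hij : i ≤ j) (k : ℤ)
    (f : (singleFunctor (ModA K n) 0).obj (intervalModule K i j) ⟶
      ((singleFunctor (ModA K n) 0).obj (intervalModule K i' j'))⟦k⟧) (hf : f ≠ 0) :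
    (k = 0 ∧ i ≤ i' ∧ i' ≤ j ∧ j ≤ j') ∨
      (k = 1 ∧ i' < i ∧ i.val ≤ j'.val + 1 ∧ j' < j) := by
  have hk0 : 0 ≤ k := by
    by_contra! h
    exact hf (single_hom_eq_zero_of_neg _ _ _ h _)
  have hk1 : k < 2 := by
    by_contra! h
    have := hasProjectiveDimensionLT_two (intervalModule K i j)
    exact hf (single_hom_eq_zero_of_projectiveDimension _ _ 2 k (by simpa using h) _)
  obtain rfl | rfl : k = 0 ∨ k = 1 := by omega
  · left
    refine ⟨rfl, ?_⟩
    obtain ⟨η, hη⟩ := (singleFunctor (ModA K n) 0).map_surjective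
      (f ≫ (shiftFunctorZero _ ℤ).hom.app _)
    refine le_of_hom_ne_zero hij η ?_
    rintro rfl
    rw [Functor.map_zero, eq_comm] at hη
    exact hf (by rwa [← cancel_mono ((shiftFunctorZero _ ℤ).hom.app _), zero_comp])
  · right
    refine ⟨rfl, ?_⟩
    have hi : i.val ≠ 0 := by
      intro hi
      have := projective_interval (K := K) i j hi
      exact hf (single_hom_eq_zero_of_projectiveDimension _ _ 1 1 le_rfl _)
    have h0 : 0 < n := by have := i.2; omega
    let k : Fin n := ⟨i.val - 1, by omega⟩
    let o : Fin n := ⟨0, h0⟩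
    have hok : o ≤ k := Fin.le_def.2 (Nat.zero_le _)
    have hoj : o ≤ j := Fin.le_def.2 (Nat.zero_le _)
    have hkj : k ≤ j := Fin.le_def.2 (by have := Fin.le_def.1 hij; simp only [k]; omega)
    have hki : k.val + 1 = i.val := by simp only [k]; omega
    have hS := intervalSES_shortExact (K := K) hok hki hij
    have hT := hS.singleTriangle_distinguished
    have h1 := projective_interval (K := K) o j rfl
    -- `M_{oj}` is projective, so `f` factors through the connecting morphism of the resolution.
    -- Hence `f` comes from a morphism `η` out of `M_{ok}`, and it vanishes as soon as `η` extends
    -- to `M_{oj}`.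
    obtain ⟨δ, hz, g, hg⟩ : ∃ δ : (singleFunctor (ModA K n) 0).obj (intervalModule K i j) ⟶
        ((singleFunctor (ModA K n) 0).obj (intervalModule K o k))⟦(1 : ℤ)⟧,
        δ ≫ ((singleFunctor (ModA K n) 0).map (intervalIncl K o k j))⟦(1 : ℤ)⟧' = 0 ∧
        ∃ g : ((singleFunctor (ModA K n) 0).obj (intervalModule K o k))⟦(1 : ℤ)⟧ ⟶
          ((singleFunctor (ModA K n) 0).obj (intervalModule K i' j'))⟦(1 : ℤ)⟧, f = δ ≫ g :=
      ⟨hS.singleδ, comp_distTriang_mor_zero₃₁ _ hT, Triangle.yoneda_exact₃ _ hT f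
        (single_hom_eq_zero_of_projectiveDimension (intervalModule K o j) _ 1 1 le_rfl _)⟩
    obtain ⟨g, rfl⟩ := (shiftFunctor (DerivedCategory (ModA K n)) (1 : ℤ)).map_surjective g
    obtain ⟨η, rfl⟩ := (singleFunctor (ModA K n) 0).map_surjective g
    have hη : ∀ θ : intervalModule K o j ⟶ intervalModule K i' j',
        η ≠ intervalIncl K o k j ≫ θ := by
      rintro θ rfl
      apply hf
      rw [hg, Functor.map_comp, Functor.map_comp, ← Category.assoc, hz, zero_comp]
    have hη0 : η ≠ 0 := by
      have := hη 0
      rwa [Limits.comp_zero] at this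
    obtain ⟨-, h2, h3⟩ := le_of_hom_ne_zero hok η hη0
    refine ⟨Fin.lt_def.2 (by have := Fin.le_def.1 h2; omega),
      by have := Fin.le_def.1 h3; omega, ?_⟩
    by_contra! hjj
    -- If `j ≤ j'`, then `j` lies in the interval of the target, and `η` extends to `M_{oj}` by
    -- sending the generator at `j` to the same multiple of the generator there.
    have hx := eq_coord_smul_gen (comp η (vtx k) (gen K o k (vtx k)))
    refine hη (ofElem (coord i' j' _ (comp η (vtx k) (gen K o k (vtx k))) • gen K i' j' (vtx j))
      (fun a _ h => absurd (Fin.lt_def.1 h) (by simp [o]))) (hom_interval_ext hok ?_)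
    obtain ⟨p⟩ := nonempty_hom (a := vtx j) (b := vtx k) hkj
    rw [comp_comp, comp_intervalIncl hkj (mem_top hok),
      comp_ofElem _ _ (show Mem o j (vtx k) from ⟨hok, hkj⟩) p, map_smul,
      trans_gen p (show Mem i' j' (vtx j) from ⟨h2.trans hkj, hjj⟩), ← hx]

lemma isIso_of_single_endomorphism {i j : Fin n} (hij : i ≤ j)
    (f : (singleFunctor (ModA K n) 0).obj (intervalModule K i j) ⟶
      (singleFunctor (ModA K n) 0).obj (intervalModule K i j)) (hf : f ≠ 0) : IsIso f := by
  obtain ⟨η, rfl⟩ := (singleFunctor (ModA K n) 0).map_surjective f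
  have := isIso_of_ne_zero hij η (by rintro rfl; exact hf (Functor.map_zero _ _ _))
  infer_instance

end DerivedIntervals

/-! ### Dimension functionals on the Grothendieck group -/

section EulerCharacteristic

open DerivedCategory DerivedCategory.TStructure LinearA ModA

variable {K : Type u} [Field K] {n : ℕ}

lemma comp_exact (a : Paths (LinearA n)ᵒᵖ) {S : ShortComplex (ModA K n)} (hS : S.Exact) :
    LinearMap.range (comp S.f a) = LinearMap.ker (comp S.g a) :=
  (hS.map (evalMod K a)).moduleCat_range_eq_ker

lemma finrank_iso (a : Paths (LinearA n)ᵒᵖ) {V W : ModA K n} (e : V ≅ W) :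
    Module.finrank K (space V a) = Module.finrank K (space W a) :=
  ((evalMod K a).mapIso e).toLinearEquiv.finrank_eq

open Classical in
lemma finrank_interval (i j : Fin n) (a : Paths (LinearA n)ᵒᵖ) :
    Module.finrank K (space (intervalModule K i j) a) = if Mem i j a then 1 else 0 := by
  rw [(intervalEquiv i j a).finrank_eq]
  split_ifs with h
  · have : Unique (PLift (Mem i j a)) := ⟨⟨⟨h⟩⟩, fun _ => rfl⟩
    simp
  · have : IsEmpty (PLift (Mem i j a)) := ⟨fun x => h x.down⟩
    simp

variable [HasDerivedCategory.{w} (ModA K n)]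

/-- The dimension of the cohomology of an object at a vertex. -/
def cohDim (a : Paths (LinearA n)ᵒᵖ) (E : DerivedCategory (ModA K n)) (m : ℤ) : ℕ :=
  Module.finrank K (space ((homologyFunctor (ModA K n) m).obj E) a)

lemma cohDim_of_isZero {a : Paths (LinearA n)ᵒᵖ} {E : DerivedCategory (ModA K n)} {m : ℤ}
    (h : IsZero ((homologyFunctor (ModA K n) m).obj E)) : cohDim a E m = 0 := by
  have : Subsingleton (space ((homologyFunctor (ModA K n) m).obj E) a) :=
    ModuleCat.subsingleton_of_isZero ((evalMod K a).map_isZero h)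
  exact Module.finrank_zero_of_subsingleton

/-- The rank of the connecting map of the long exact cohomology sequence. -/
def connRank (a : Paths (LinearA n)ᵒᵖ) (T : Triangle (DerivedCategory (ModA K n))) (m : ℤ) : ℕ :=
  Module.finrank K (LinearMap.range (comp (HomologySequence.δ T m (m + 1)) a))

/-- Rank–nullity at three consecutive places of the long exact cohomology sequence. The failure of
additivity is expressed by ranks of connecting maps alone. -/
lemma cohDim_triangle (a : Paths (LinearA n)ᵒᵖ) {T : Triangle (DerivedCategory (ModA K n))}
    (hT : T ∈ distTriang _) (m : ℤ) :
    cohDim a T.obj₂ (m + 1) + connRank a T m + connRank a T (m + 1) =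
      cohDim a T.obj₁ (m + 1) + cohDim a T.obj₃ (m + 1) := by
  have e1 := comp_exact a (HomologySequence.exact₁ T hT m (m + 1) rfl)
  have e2 := comp_exact a (HomologySequence.exact₂ T hT (m + 1))
  have e3 := comp_exact a (HomologySequence.exact₃ T hT (m + 1) (m + 1 + 1) rfl)
  have r1 := LinearMap.finrank_range_add_finrank_ker
    (comp ((homologyFunctor (ModA K n) (m + 1)).map T.mor₁) a)
  have r2 := LinearMap.finrank_range_add_finrank_ker
    (comp ((homologyFunctor (ModA K n) (m + 1)).map T.mor₂) a)
  have r3 := LinearMap.finrank_range_add_finrank_ker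
    (comp (HomologySequence.δ T (m + 1) (m + 1 + 1)) a)
  dsimp only at e1 e2 e3
  rw [← e1] at r1
  rw [← e2] at r2
  rw [← e3] at r3
  unfold cohDim connRank
  omega

/-- The Euler characteristic of the cohomology of an object at a vertex. -/
def eulerChar (a : Paths (LinearA n)ᵒᵖ) (E : DerivedCategory (ModA K n)) : ℤ :=
  ∑ᶠ m : ℤ, (m.negOnePow : ℤ) * cohDim a E m

lemma finite_support_cohDim (a : Paths (LinearA n)ᵒᵖ) {E : DerivedCategory (ModA K n)}
    (hE : t.bounded E) : (Function.support fun m => cohDim a E m).Finite := by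
  obtain ⟨⟨x, hx⟩, ⟨y, hy⟩⟩ := hE
  refine (Set.finite_Icc x y).subset fun m hm => ?_
  by_contra h
  rw [Set.mem_Icc, not_and_or, not_le, not_le] at h
  rcases h with h | h
  · exact hm (cohDim_of_isZero (isZero_of_isGE E x m h))
  · exact hm (cohDim_of_isZero (isZero_of_isLE E y m h))

lemma finite_support_smul {f : ℤ → ℕ} (hf : (Function.support f).Finite) :
    (Function.support fun m : ℤ => (m.negOnePow : ℤ) * (f m : ℤ)).Finite := by
  refine hf.subset fun m hm h => hm ?_
  simp [h]

/-- The two families of connecting ranks differ by a shift of degree by one, hence by a sign in the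
alternating sum, and cancel. Boundedness makes the sums finite. -/
lemma eulerChar_triangle (a : Paths (LinearA n)ᵒᵖ) {T : Triangle (DerivedCategory (ModA K n))}
    (hT : T ∈ distTriang _) (h₁ : t.bounded T.obj₁) (h₂ : t.bounded T.obj₂)
    (h₃ : t.bounded T.obj₃) :
    eulerChar a T.obj₂ = eulerChar a T.obj₁ + eulerChar a T.obj₃ := by
  have f1 := finite_support_smul (finite_support_cohDim a h₁)
  have f2 := finite_support_smul (finite_support_cohDim a h₂)
  have f3 := finite_support_smul (finite_support_cohDim a h₃)
  have hr : (Function.support fun m => connRank a T m).Finite := by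
    refine (finite_support_cohDim a h₃).subset fun m hm h => hm ?_
    have := LinearMap.finrank_range_le (comp (HomologySequence.δ T m (m + 1)) a)
    exact Nat.le_zero.1 (this.trans_eq h)
  have fr := finite_support_smul hr
  have fr' : (Function.support fun m : ℤ =>
      (m.negOnePow : ℤ) * (connRank a T (m - 1) : ℤ)).Finite := by
    refine finite_support_smul (f := fun m => connRank a T (m - 1)) ?_
    exact hr.preimage (f := fun m : ℤ => m - 1) (sub_left_injective.injOn)
  have hsum : ∑ᶠ m : ℤ, (m.negOnePow : ℤ) * (connRank a T (m - 1) : ℤ) =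
      - ∑ᶠ m : ℤ, (m.negOnePow : ℤ) * (connRank a T m : ℤ) := by
    rw [← finsum_comp_equiv (Equiv.addRight (1 : ℤ)), ← finsum_neg_distrib]
    refine finsum_congr fun m => ?_
    simp [Int.negOnePow_succ]
  have key : eulerChar a T.obj₂ + (∑ᶠ m : ℤ, (m.negOnePow : ℤ) * (connRank a T (m - 1) : ℤ) +
      ∑ᶠ m : ℤ, (m.negOnePow : ℤ) * (connRank a T m : ℤ)) =
      eulerChar a T.obj₁ + eulerChar a T.obj₃ := by
    unfold eulerChar
    rw [← finsum_add_distrib fr' fr, ← finsum_add_distrib f1 f3, ← finsum_add_distrib f2]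
    · refine finsum_congr fun m => ?_
      have := cohDim_triangle a hT (m - 1)
      rw [sub_add_cancel] at this
      have h' : (cohDim a T.obj₂ m : ℤ) + connRank a T (m - 1) + connRank a T m =
        cohDim a T.obj₁ m + cohDim a T.obj₃ m := by exact_mod_cast this
      linear_combination (m.negOnePow : ℤ) * h'
    · exact (fr'.union fr).subset (Function.support_add _ _)
  rw [hsum, neg_add_cancel, add_zero] at key
  exact key

/-- The Euler characteristic at a vertex, as a function on the Grothendieck group. -/
def dimAt (a : Paths (LinearA n)ᵒᵖ) : GrothendieckK (DbA K n) →+ ℤ :=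
  QuotientAddGroup.lift _ (FreeAbelianGroup.lift fun E : DbA K n => eulerChar a E.obj) (by
    rw [grothendieckRelations, AddSubgroup.closure_le]
    rintro _ ⟨T, hT, rfl⟩
    have h := eulerChar_triangle a ((Bounded.ι (C := ModA K n)).map_distinguished T hT)
      T.obj₁.property T.obj₂.property T.obj₃.property
    change eulerChar a T.obj₂.obj = eulerChar a T.obj₁.obj + eulerChar a T.obj₃.obj at h
    simp [h])

lemma dimAt_kClass (a : Paths (LinearA n)ᵒᵖ) (E : DbA K n) :
    dimAt a (kClass E) = eulerChar a E.obj := by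
  change FreeAbelianGroup.lift _ (FreeAbelianGroup.of E) = _
  simp

open Classical in
lemma dimAt_MA (i j : Fin n) (a : Paths (LinearA n)ᵒᵖ) :
    dimAt a (kClass (MA K i j)) = if Mem i j a then 1 else 0 := by
  rw [dimAt_kClass, eulerChar]
  rw [finsum_eq_single _ 0]
  · have h := finrank_iso a
      ((singleFunctorCompHomologyFunctorIso (ModA K n) 0).app (intervalModule K i j))
    rw [Functor.id_obj, finrank_interval] at h
    unfold cohDim
    simp only [Int.negOnePow_zero, Units.val_one, one_mul]
    erw [h]
    split_ifs <;> simp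
  · intro m hm
    rw [cohDim_of_isZero, Nat.cast_zero, mul_zero]
    rcases hm.lt_or_gt with h | h
    · exact isZero_of_isGE ((singleFunctor (ModA K n) 0).obj (intervalModule K i j)) 0 m h
    · exact isZero_of_isLE ((singleFunctor (ModA K n) 0).obj (intervalModule K i j)) 0 m h

end EulerCharacteristic

/-! ### Phases of complex numbers and convexity of polygons -/

section Phases

/-- The nonzero complex number `z` lies on the ray of phase `φ`. -/
def IsPhase (z : ℂ) (φ : ℝ) : Prop :=
  ∃ m : ℝ, 0 < m ∧ z = m * Complex.exp (Complex.I * Real.pi * φ)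

lemma IsPhase.ne_zero {z : ℂ} {φ : ℝ} (h : IsPhase z φ) : z ≠ 0 := by
  obtain ⟨m, hm, rfl⟩ := h
  exact mul_ne_zero (by exact_mod_cast hm.ne') (Complex.exp_ne_zero _)

lemma IsPhase.mul {z z' : ℂ} {φ φ' : ℝ} (h : IsPhase z φ) (h' : IsPhase z' φ') :
    IsPhase (z * z') (φ + φ') := by
  obtain ⟨m, hm, rfl⟩ := h
  obtain ⟨m', hm', rfl⟩ := h'
  refine ⟨m * m', by positivity, ?_⟩
  push_cast
  rw [mul_add, Complex.exp_add]
  ring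

lemma IsPhase.add {z z' : ℂ} {φ : ℝ} (h : IsPhase z φ) (h' : IsPhase z' φ) :
    IsPhase (z + z') φ ∧ ‖z + z'‖ = ‖z‖ + ‖z'‖ := by
  obtain ⟨m, hm, rfl⟩ := h
  obtain ⟨m', hm', rfl⟩ := h'
  refine ⟨⟨m + m', by positivity, by push_cast; ring⟩, ?_⟩
  rw [← add_mul, norm_mul, norm_mul, norm_mul, ← add_mul, ← Complex.ofReal_add]
  simp only [Complex.norm_real, Real.norm_eq_abs, abs_of_pos hm, abs_of_pos hm',
    abs_of_pos (add_pos hm hm')]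

lemma isPhase_arg {z : ℂ} (hz : z ≠ 0) : IsPhase z (z.arg / Real.pi) := by
  refine ⟨‖z‖, by positivity, ?_⟩
  have h : Complex.I * Real.pi * ((z.arg / Real.pi : ℝ) : ℂ) = z.arg * Complex.I := by
    have : (Real.pi : ℂ) ≠ 0 := by exact_mod_cast Real.pi_ne_zero
    push_cast
    field_simp
  rw [h, Complex.norm_mul_exp_arg_mul_I]

lemma IsPhase.negOnePow {z : ℂ} {φ : ℝ} (h : IsPhase z φ) (k : ℤ) :
    IsPhase ((k.negOnePow : ℤ) • z) (φ + k) := by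
  obtain ⟨m, hm, rfl⟩ := h
  refine ⟨m, hm, ?_⟩
  have h1 : Complex.exp (Complex.I * Real.pi * ((φ + k : ℝ) : ℂ)) =
      Complex.exp (Complex.I * Real.pi * φ) * (-1) ^ k := by
    rw [← Complex.exp_pi_mul_I, ← Complex.exp_int_mul, ← Complex.exp_add]
    push_cast
    ring_nf
  rw [h1]
  rcases Int.even_or_odd k with hk | hk
  · simp [Int.negOnePow_even k hk, hk.neg_one_zpow]
  · simp [Int.negOnePow_odd k hk, hk.neg_one_zpow]

lemma IsPhase.im_conj_mul {z z' : ℂ} {φ φ' : ℝ} (h : IsPhase z φ) (h' : IsPhase z' φ') :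
    ∃ m : ℝ, 0 < m ∧ (starRingEnd ℂ z * z').im = m * Real.sin (Real.pi * (φ' - φ)) := by
  obtain ⟨m, hm, rfl⟩ := h
  obtain ⟨m', hm', rfl⟩ := h'
  refine ⟨m * m', by positivity, ?_⟩
  rw [map_mul, ← Complex.exp_conj, Complex.conj_ofReal]
  have h : (m : ℂ) * Complex.exp (starRingEnd ℂ (Complex.I * Real.pi * φ)) *
      (m' * Complex.exp (Complex.I * Real.pi * φ')) =
      ((m * m' : ℝ) : ℂ) * Complex.exp (((Real.pi * (φ' - φ) : ℝ) : ℂ) * Complex.I) := by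
    have : Complex.exp (((Real.pi * (φ' - φ) : ℝ) : ℂ) * Complex.I) =
        Complex.exp (starRingEnd ℂ (Complex.I * Real.pi * φ)) *
        Complex.exp (Complex.I * Real.pi * φ') := by
      rw [← Complex.exp_add]
      congr 1
      simp only [map_mul, Complex.conj_I, Complex.conj_ofReal]
      push_cast
      ring
    rw [this]
    push_cast
    ring
  rw [h, Complex.im_ofReal_mul, Complex.exp_ofReal_mul_I_im]

lemma im_conj_mul_pos {z z' : ℂ} {φ φ' : ℝ} (h : IsPhase z φ) (h' : IsPhase z' φ')
    (h0 : φ < φ') (h1 : φ' < φ + 1) : 0 < (starRingEnd ℂ z * z').im := by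
  obtain ⟨m, hm, e⟩ := h.im_conj_mul h'
  rw [e]
  refine mul_pos hm (Real.sin_pos_of_pos_of_lt_pi ?_ ?_)
  · exact mul_pos Real.pi_pos (by linarith)
  · nlinarith [Real.pi_pos]

/-- The imaginary part has the sign of `sin (π (φ' - φ))`, which on the window `[-1, 2]` for `φ' -
φ` is positive only on `(0, 1)`. -/
lemma phase_lt_of_im_conj_mul_pos {z z' : ℂ} {φ φ' : ℝ} (h : IsPhase z φ) (h' : IsPhase z' φ')
    (h0 : 0 < (starRingEnd ℂ z * z').im) (h1 : φ - 1 ≤ φ') (h2 : φ' ≤ φ + 2) :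
    φ < φ' ∧ φ' < φ + 1 := by
  obtain ⟨m, hm, e⟩ := h.im_conj_mul h'
  rw [e] at h0
  have hs : 0 < Real.sin (Real.pi * (φ' - φ)) := (pos_iff_pos_of_mul_pos h0).1 hm
  constructor
  · by_contra! hle
    refine hs.not_ge (Real.sin_nonpos_of_nonpos_of_neg_pi_le ?_ ?_)
    · exact mul_nonpos_of_nonneg_of_nonpos Real.pi_pos.le (by linarith)
    · nlinarith [Real.pi_pos]
  · by_contra! hle
    have : Real.sin (Real.pi * (φ' - φ)) = - Real.sin (Real.pi * (φ' - φ - 1)) := by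
      rw [← Real.sin_add_pi]
      congr 1
      ring
    rw [this] at hs
    have h3 : 0 ≤ Real.sin (Real.pi * (φ' - φ - 1)) := by
      refine Real.sin_nonneg_of_nonneg_of_le_pi ?_ ?_
      · exact mul_nonneg Real.pi_pos.le (by linarith)
      · nlinarith [Real.pi_pos]
    linarith

/-- The phase of a complex number is unique in an open interval of length two. -/
lemma IsPhase.unique {z : ℂ} {φ φ' : ℝ} (h : IsPhase z φ) (h' : IsPhase z φ')
    (h1 : φ < φ' + 2) (h2 : φ' < φ + 2) : φ = φ' := by
  obtain ⟨m, hm, e⟩ := h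
  obtain ⟨m', hm', e'⟩ := h'
  have hn : m = m' := by
    have a1 : ‖z‖ = m := by rw [e]; simp [Complex.norm_exp, hm.le]
    have a2 : ‖z‖ = m' := by rw [e']; simp [Complex.norm_exp, hm'.le]
    exact a1.symm.trans a2
  subst hn
  rw [e] at e'
  have hm0 : (m : ℂ) ≠ 0 := by exact_mod_cast hm.ne'
  obtain ⟨k, hk⟩ := Complex.exp_eq_exp_iff_exists_int.1 (mul_left_cancel₀ hm0 e')
  have h3 : φ = φ' + 2 * k := by
    have h4 : Complex.I * Real.pi * φ = Complex.I * Real.pi * (φ' + 2 * k) := by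
      rw [hk]; ring
    have h5 : (Complex.I * Real.pi : ℂ) ≠ 0 :=
      mul_ne_zero Complex.I_ne_zero (by exact_mod_cast Real.pi_ne_zero)
    exact_mod_cast mul_left_cancel₀ h5 h4
  have hk0 : k = 0 := by
    have a : (k : ℝ) < 1 := by linarith
    have b : (-1 : ℝ) < k := by linarith
    have a' : k < 1 := by exact_mod_cast a
    have b' : -1 < k := by exact_mod_cast b
    omega
  simp [h3, hk0]

/-- The phases of the sides and diagonals of a polygon are compatible. -/
structure ChordPhases (n : ℕ) (p : ℕ → ℂ) (φ : ℕ → ℕ → ℝ) : Prop where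
  isPhase : ∀ {a b}, a < b → b ≤ n → IsPhase (p b - p a) (φ a b)
  -- Together `lt₁`, `lt₂`, `lt₃` say that phases increase along `M a b ⟶ M a c ⟶ M b c ⟶ (M a
  -- b)⟦1⟧`.
  lt₁ : ∀ {a b c}, a < b → b < c → c ≤ n → φ a b < φ a c
  lt₂ : ∀ {a b c}, a < b → b < c → c ≤ n → φ a c < φ b c
  lt₃ : ∀ {a b c}, a < b → b < c → c ≤ n → φ b c < φ a b + 1

/-- The polygon is convex and anticlockwise oriented. -/
def ConvexSeq (n : ℕ) (p : ℕ → ℂ) : Prop :=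
  ∀ a b c, a < b → b < c → c ≤ n → 0 < ((starRingEnd ℂ (p b - p a)) * (p c - p a)).im

lemma ChordPhases.convexSeq {n : ℕ} {p : ℕ → ℂ} {φ : ℕ → ℕ → ℝ} (h : ChordPhases n p φ) :
    ConvexSeq n p := fun _ _ _ hab hbc hcn =>
  im_conj_mul_pos (h.isPhase hab (by omega)) (h.isPhase (hab.trans hbc) hcn) (h.lt₁ hab hbc hcn)
    ((h.lt₂ hab hbc hcn).trans (h.lt₃ hab hbc hcn))

/-- The polygon gives a phase modulo two. The inequalities put `φ 0 b` in `(φ 0 1, φ 0 1 + 1)` for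
`b > 1`, and then `φ a b` in `(φ 0 b, φ 0 a + 1)` for `a > 0`; these intervals are too short for two
candidates. -/
lemma ChordPhases.eq {n : ℕ} {p : ℕ → ℂ} {φ φ' : ℕ → ℕ → ℝ} (h : ChordPhases n p φ)
    (h' : ChordPhases n p φ') (h01 : φ 0 1 = φ' 0 1) {a b : ℕ} (hab : a < b) (hb : b ≤ n) :
    φ a b = φ' a b := by
  have h0 : ∀ b, 0 < b → b ≤ n → φ 0 b = φ' 0 b := by
    intro b hb0 hb
    obtain rfl | hb1 : b = 1 ∨ 1 < b := by omega
    · exact h01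
    · have a1 := h.lt₁ one_pos hb1 hb
      have a2 := (h.lt₂ one_pos hb1 hb).trans (h.lt₃ one_pos hb1 hb)
      have b1 := h'.lt₁ one_pos hb1 hb
      have b2 := (h'.lt₂ one_pos hb1 hb).trans (h'.lt₃ one_pos hb1 hb)
      exact (h.isPhase hb0 hb).unique (h'.isPhase hb0 hb) (by linarith) (by linarith)
  obtain rfl | ha : a = 0 ∨ 0 < a := by omega
  · exact h0 b hab hb
  · have e := h0 b (by omega) hb
    have e' := h0 a ha (by omega)
    have a1 := h.lt₂ ha hab hb
    have a2 := h.lt₃ ha hab hb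
    have b1 := h'.lt₂ ha hab hb
    have b2 := h'.lt₃ ha hab hb
    have c1 := h.lt₁ ha hab hb
    exact (h.isPhase hab hb).unique (h'.isPhase hab hb) (by linarith) (by linarith)

/-- The phases of the sides and diagonals of a convex polygon. -/
def chordPhase (p : ℕ → ℂ) (a b : ℕ) : ℝ :=
  -- Measuring the chord relative to `p b` avoids the branch cut: for a convex polygon with `p 0 =
  -- 0` and `p 1 = 1`, both arguments lie in `[0, π)` whenever `a < b ≤ n`.
  (p b).arg / Real.pi + ((p b - p a) / p b).arg / Real.pi

lemma abs_arg_div_pi (z : ℂ) : -1 < z.arg / Real.pi ∧ z.arg / Real.pi ≤ 1 := by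
  constructor
  · rw [lt_div_iff₀ Real.pi_pos]
    linarith [Complex.neg_pi_lt_arg z]
  · rw [div_le_one Real.pi_pos]
    exact Complex.arg_le_pi z

/-- Orientation compares phases only inside a bounded window, so the windows are narrowed in stages:
the chords from vertex `0` have phases increasing in `[0, 1)`. Triangles with vertex `0` then
confine `φ a b` to `(φ 0 b, φ 0 a + 1)`, which suffices to compare phases in every other triangle.
-/
lemma chordPhases_of_convexSeq {n : ℕ} {p : ℕ → ℂ} (h0 : p 0 = 0) (h1 : p 1 = 1)
    (h : ConvexSeq n p) : ChordPhases n p (chordPhase p) ∧ chordPhase p 0 1 = 0 := by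
  have hne : ∀ b, 0 < b → b ≤ n → p b ≠ 0 := by
    intro b hb0 hb e
    obtain rfl | hb1 : b = 1 ∨ 1 < b := by omega
    · simp [h1] at e
    · have := h 0 1 b one_pos hb1 hb
      simp [h0, e] at this
  have hne' : ∀ a b, a < b → b ≤ n → p b - p a ≠ 0 := by
    intro a b hab hb e
    obtain rfl | ha : a = 0 ∨ 0 < a := by omega
    · exact hne b hab hb (by simpa [h0] using e)
    · have := h 0 a b ha hab hb
      rw [sub_eq_zero.1 e] at this
      simp [h0, mul_comm] at this
  have hph : ∀ {a b}, a < b → b ≤ n → IsPhase (p b - p a) (chordPhase p a b) := by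
    intro a b hab hb
    have hb0 := hne b (by omega) hb
    have := (isPhase_arg hb0).mul (isPhase_arg (div_ne_zero (hne' a b hab hb) hb0))
    rwa [mul_div_cancel₀ _ hb0] at this
  have hθ : ∀ b, 0 < b → b ≤ n → chordPhase p 0 b = (p b).arg / Real.pi := by
    intro b hb0 hb
    simp [chordPhase, h0, hne b hb0 hb]
  have h01 : chordPhase p 0 1 = 0 := by simp [chordPhase, h0, h1]
  have hp0 : ∀ b, 0 < b → b ≤ n → IsPhase (p b) (chordPhase p 0 b) := by
    intro b hb0 hb
    simpa [h0] using hph hb0 hb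
  have hpos : ∀ b, 0 < b → b ≤ n → 0 ≤ chordPhase p 0 b ∧ chordPhase p 0 b < 1 := by
    intro b hb0 hb
    obtain rfl | hb1 : b = 1 ∨ 1 < b := by omega
    · simp [h01]
    · have him := h 0 1 b one_pos hb1 hb
      have := abs_arg_div_pi (p b)
      rw [← hθ b hb0 hb] at this
      have := phase_lt_of_im_conj_mul_pos (hph one_pos (by omega)) (hph hb0 hb) him
        (by linarith) (by linarith)
      constructor <;> linarith
  have hinc : ∀ a b, 0 < a → a < b → b ≤ n → chordPhase p 0 a < chordPhase p 0 b := by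
    intro a b ha hab hb
    have a1 := hpos a ha (by omega)
    have a2 := hpos b (by omega) hb
    exact (phase_lt_of_im_conj_mul_pos (hph ha (by omega)) (hph (by omega) hb) (h 0 a b ha hab hb)
        (by linarith) (by linarith)).1
  have hrange : ∀ a b, 0 < a → a < b → b ≤ n → chordPhase p 0 b < chordPhase p a b ∧
      chordPhase p a b < chordPhase p 0 a + 1 := by
    intro a b ha hab hb
    have him := h 0 a b ha hab hb
    rw [h0, sub_zero, sub_zero] at him
    have him1 : 0 < (starRingEnd ℂ (p b) * (p b - p a)).im := by
      simp only [Complex.mul_im, Complex.conj_re, Complex.conj_im, Complex.sub_re,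
        Complex.sub_im] at him ⊢
      linarith
    have him2 : 0 < (starRingEnd ℂ (p a) * (p b - p a)).im := by
      simp only [Complex.mul_im, Complex.conj_re, Complex.conj_im, Complex.sub_re,
        Complex.sub_im] at him ⊢
      linarith
    have hb0 : 0 < b := by omega
    have hd := abs_arg_div_pi ((p b - p a) / p b)
    have hdef : chordPhase p a b = chordPhase p 0 b + ((p b - p a) / p b).arg / Real.pi := by
      rw [hθ b hb0 hb]; rfl
    have h2 := phase_lt_of_im_conj_mul_pos (hp0 b hb0 hb) (hph hab hb) him1
      (by linarith) (by linarith)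
    have h3 := hinc a b ha hab hb
    have h4 := hpos b hb0 hb
    have h5 := hpos a ha (by omega)
    have h6 := phase_lt_of_im_conj_mul_pos (hp0 a ha (by omega)) (hph hab hb) him2
      (by linarith) (by linarith)
    exact ⟨h2.1, h6.2⟩
  have key : ∀ {a b c}, a < b → b < c → c ≤ n → chordPhase p a b < chordPhase p a c ∧
      chordPhase p a c < chordPhase p b c ∧ chordPhase p b c < chordPhase p a b + 1 := by
    intro a b c hab hbc hc
    have hbc0 := hrange b c (by omega) hbc hc
    have i0 := hinc b c (by omega) hbc hc
    obtain rfl | ha : a = 0 ∨ 0 < a := by omega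
    · exact ⟨i0, hbc0⟩
    · have hab0 := hrange a b ha hab (by omega)
      have hac0 := hrange a c ha (hab.trans hbc) hc
      have i1 := hinc a b ha hab (by omega)
      have him := h a b c hab hbc hc
      have him2 : 0 < (starRingEnd ℂ (p c - p a) * (p c - p b)).im := by
        simp only [Complex.mul_im, Complex.conj_re, Complex.conj_im, Complex.sub_re,
          Complex.sub_im] at him ⊢
        linarith
      have p1 := hpos a ha (by omega)
      have p2 := hpos b (by omega) (by omega)
      have p3 := hpos c (by omega) hc
      have k1 := phase_lt_of_im_conj_mul_pos (hph hab (by omega)) (hph (hab.trans hbc) hc) him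
        (by linarith) (by linarith)
      have k2 := phase_lt_of_im_conj_mul_pos (hph (hab.trans hbc) hc) (hph hbc hc) him2
        (by linarith) (by linarith)
      exact ⟨k1.1, k2.1, by linarith⟩
  exact ⟨⟨hph, fun x y z => (key x y z).1, fun x y z => (key x y z).2.1,
    fun x y z => (key x y z).2.2⟩, h01⟩

end Phases

/-! ### Classes in the Grothendieck group and triangles of stable objects -/

section StabilityGeneral

variable {D : Type u} [Category.{v} D] [HasZeroObject D] [HasShift D ℤ] [Preadditive D]
  [∀ n : ℤ, (shiftFunctor D n).Additive] [Pretriangulated D]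

lemma kClass_triangle {T : Triangle D} (hT : T ∈ distTriang D) :
    kClass T.obj₂ = kClass T.obj₁ + kClass T.obj₃ := by
  have h : QuotientAddGroup.mk' (grothendieckRelations D)
      (FreeAbelianGroup.of T.obj₂ - FreeAbelianGroup.of T.obj₁ - FreeAbelianGroup.of T.obj₃) = 0 :=
    (QuotientAddGroup.eq_zero_iff _).2 (AddSubgroup.subset_closure ⟨T, hT, rfl⟩)
  rw [map_sub, map_sub, sub_sub, sub_eq_zero] at h
  exact h

lemma kClass_of_isZero {E : D} (h : IsZero E) : kClass E = 0 := by
  have h1 := kClass_triangle (contractible_distinguished E)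
  have h2 := kClass_triangle (T := Triangle.mk (0 : E ⟶ E) (0 : E ⟶ E) 0)
    (isomorphic_distinguished _ (contractible_distinguished E) _
      (Triangle.isoMk _ _ (Iso.refl _) (Iso.refl _) (h.iso (isZero_zero D))
        (h.eq_of_src _ _) (h.eq_of_src _ _) (h.eq_of_src _ _)))
  change kClass E = kClass E + kClass E at h2
  exact left_eq_add.1 h2

open ZeroObject in
lemma kClass_iso {E F : D} (e : E ≅ F) : kClass E = kClass F := by
  have h := kClass_triangle (T := Triangle.mk e.inv (0 : E ⟶ (0 : D)) 0)
    ((Triangle.distinguished_iff_of_isZero₃ _ (isZero_zero D)).2 (inferInstanceAs (IsIso e.inv)))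
  change kClass E = kClass F + kClass (0 : D) at h
  rw [h, kClass_of_isZero (isZero_zero D), add_zero]

lemma kClass_biprod (E F : D) : kClass (E ⊞ F) = kClass E + kClass F :=
  kClass_triangle (binaryBiproductTriangle_distinguished E F)

open ZeroObject in
lemma kClass_shift_one (E : D) : kClass (E⟦(1 : ℤ)⟧) = - kClass E := by
  have h := kClass_triangle (rot_of_distTriang _ (contractible_distinguished E))
  change kClass (0 : D) = kClass E + kClass (E⟦(1 : ℤ)⟧) at h
  rw [kClass_of_isZero (isZero_zero D)] at h
  exact (neg_eq_of_add_eq_zero_right h.symm).symm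

lemma kClass_shift (E : D) (k : ℤ) : kClass (E⟦k⟧) = (k.negOnePow : ℤ) • kClass E := by
  have step : ∀ k : ℤ, kClass (E⟦k + 1⟧) = - kClass (E⟦k⟧) := fun k => by
    rw [kClass_iso ((shiftFunctorAdd D k 1).app E)]
    exact kClass_shift_one _
  induction k using Int.induction_on with
  | zero => simpa using kClass_iso ((shiftFunctorZero D ℤ).app E)
  | succ k ih => rw [step, ih, Int.negOnePow_succ]; simp
  | pred k ih =>
    have := step (-k - 1)
    rw [sub_add_cancel, ih] at this
    rw [← neg_eq_iff_eq_neg] at this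
    rw [← this, Int.negOnePow_sub]
    simp

lemma grothendieckK_hom_ext {G : Type*} [AddCommGroup G] {f g : GrothendieckK D →+ G}
    (h : ∀ E, f (kClass E) = g (kClass E)) : f = g := by
  apply QuotientAddGroup.addMonoidHom_ext
  apply FreeAbelianGroup.lift_ext
  exact h

lemma kClass_dsum_ext {ι : Type*} {X : ι → D} (hX : ∀ E : D, IsDSum X E)
    {G : Type*} [AddCommGroup G] {f g : GrothendieckK D →+ G}
    (h : ∀ i, f (kClass (X i)) = g (kClass (X i))) : f = g := by
  apply grothendieckK_hom_ext
  intro E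
  obtain ⟨L, ⟨e⟩⟩ := hX E
  rw [kClass_iso e]
  clear e
  induction L with
  | nil => rw [kClass_of_isZero (dsum_nil X), map_zero, map_zero]
  | cons i L ih =>
    rw [kClass_iso (dsumCons X i L), kClass_biprod, map_add, map_add, ih, h]

/-- In a distinguished triangle of nonzero indecomposable objects all the morphisms are nonzero. -/
lemma mor_ne_zero_of_indecomposable {T : Triangle D} (hT : T ∈ distTriang D)
    (h₁ : Indecomposable T.obj₁) (h₂ : Indecomposable T.obj₂) (h₃ : Indecomposable T.obj₃) :
    T.mor₁ ≠ 0 ∧ T.mor₂ ≠ 0 ∧ T.mor₃ ≠ 0 := by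
  have hshift : ∀ (k : ℤ) (E : D), IsZero (E⟦k⟧) → IsZero E := fun k E h => by
    rw [IsZero.iff_id_eq_zero] at h ⊢
    apply (shiftFunctor D k).map_injective
    rw [CategoryTheory.Functor.map_id, h, Functor.map_zero]
  -- A vanishing morphism splits the triangle and exhibits one vertex, up to shift, as a direct sum
  -- of the other two.
  refine ⟨fun h => ?_, fun h => ?_, fun h => ?_⟩
  · obtain ⟨e, -⟩ := exists_iso_binaryBiproduct_of_distTriang _ (rot_of_distTriang _ hT)
      (show -T.mor₁⟦(1 : ℤ)⟧' = 0 by rw [h, Functor.map_zero, neg_zero])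
    rcases h₃.2 _ _ e with h' | h'
    · exact h₂.1 h'
    · exact h₁.1 (hshift _ _ h')
  · obtain ⟨e, -⟩ := exists_iso_binaryBiproduct_of_distTriang _ (inv_rot_of_distTriang _ hT)
      (show T.mor₂ ≫ _ = 0 by rw [h]; exact zero_comp)
    rcases h₁.2 _ _ e with h' | h'
    · exact h₃.1 (hshift _ _ h')
    · exact h₂.1 h'
  · obtain ⟨e, -⟩ := exists_iso_binaryBiproduct_of_distTriang _ hT h
    rcases h₂.2 _ _ e with h' | h'
    · exact h₁.1 h'
    · exact h₃.1 h'

namespace StabilityCondition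

variable (σ : StabilityCondition D)

instance (φ : ℝ) : (σ.P φ).IsClosedUnderIsomorphisms := σ.replete φ
instance (φ : ℝ) : (σ.P φ).IsClosedUnderFiniteProducts := σ.additive φ

lemma prop_shift (k : ℤ) (φ : ℝ) (E : D) : σ.P (φ + k) (E⟦k⟧) ↔ σ.P φ E := by
  have step : ∀ k : ℤ, σ.P (φ + (k + 1 : ℤ)) (E⟦k + 1⟧) ↔ σ.P (φ + k) (E⟦k⟧) := fun k => by
    rw [(σ.P _).prop_iff_of_iso ((shiftFunctorAdd D k 1).app E), ← σ.shift (φ + k)]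
    push_cast
    rw [add_assoc]
    rfl
  induction k using Int.induction_on with
  | zero =>
    rw [(σ.P _).prop_iff_of_iso ((shiftFunctorZero D ℤ).app E)]
    simp
  | succ k ih => exact (step k).trans ih
  | pred k ih =>
    rw [← step (-k - 1), sub_add_cancel]
    exact ih

lemma prop_biprod {φ : ℝ} {E F : D} (hE : σ.P φ E) (hF : σ.P φ F) : σ.P φ (E ⊞ F) :=
  (σ.P φ).prop_of_iso (biprod.isoProd E F).symm ((σ.P φ).prop_prod E F hE hF)

lemma prop_of_isZero (φ : ℝ) {E : D} (hE : IsZero E) : σ.P φ E :=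
  (σ.P φ).prop_of_isTerminal E hE.isTerminal

lemma prop_dsum {φ : ℝ} {ι : Type*} {X : ι → D} {L : List ι} (h : ∀ i ∈ L, σ.P φ (X i)) :
    σ.P φ (dsum X L) := by
  induction L with
  | nil => exact σ.prop_of_isZero φ (dsum_nil X)
  | cons i L ih =>
    exact (σ.P φ).prop_of_iso (dsumCons X i L).symm
      (σ.prop_biprod (h i (by simp)) (ih fun j hj => h j (by simp [hj])))

/-- In a distinguished triangle of stable objects with nonzero morphisms, phases increase
strictly. -/
lemma phase_lt_of_triangle {T : Triangle D} (hT : T ∈ distTriang D) {α β γ : ℝ}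
    (h₁ : σ.P α T.obj₁) (h₂ : σ.P β T.obj₂) (h₃ : σ.P γ T.obj₃)
    (s₁ : Simple (⟨T.obj₁, h₁⟩ : (σ.P α).FullSubcategory))
    (s₂ : Simple (⟨T.obj₂, h₂⟩ : (σ.P β).FullSubcategory))
    (m₁ : T.mor₁ ≠ 0) (m₂ : T.mor₂ ≠ 0) (m₃ : T.mor₃ ≠ 0) : α < β := by
  have hαβ : α ≤ β := by
    by_contra! h
    exact m₁ (σ.hom_eq_zero _ _ h _ _ h₁ h₂ _)
  -- If `α = β`, then `γ ≤ α + 1` leaves two cases. In each, a nonzero monomorphism into a simple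
  -- object of `P α` is an isomorphism, so the third vertex of its triangle is zero and some
  -- morphism of `T` vanishes.
  refine hαβ.lt_of_ne fun hh => ?_
  subst hh
  have hγ : γ ≤ α + 1 := by
    by_contra! h
    exact m₃ (σ.hom_eq_zero _ _ h _ _ h₃ ((σ.shift α _).2 h₁) _)
  have hT' := inv_rot_of_distTriang _ hT
  have hT'' := inv_rot_of_distTriang _ hT'
  have h₃' : σ.P (γ - 1) (T.obj₃⟦(-1 : ℤ)⟧) := by
    have := (σ.prop_shift (-1) γ T.obj₃).2 h₃
    push_cast at this
    exact this
  have h₂' : σ.P (α - 1) (T.obj₂⟦(-1 : ℤ)⟧) := by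
    have := (σ.prop_shift (-1) α T.obj₂).2 h₂
    push_cast at this
    exact this
  rcases hγ.lt_or_eq with hγ | hγ
  -- A morphism from `P α` killed by `T.mor₁` factors through `T.obj₃⟦-1⟧`, whose phase `γ - 1` is
  -- below `α`.
  · let f : (⟨T.obj₁, h₁⟩ : (σ.P α).FullSubcategory) ⟶ ⟨T.obj₂, h₂⟩ := ⟨T.mor₁⟩
    have hmono : Mono f := by
      refine Preadditive.mono_of_cancel_zero f fun {X} g hg => ?_
      have hg' : g.hom ≫ T.mor₁ = 0 := congrArg (fun x => x.hom) hg
      obtain ⟨g', hg'⟩ := Triangle.coyoneda_exact₂ _ hT' g.hom hg'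
      have h0 : g' = 0 := σ.hom_eq_zero _ _ (show γ - 1 < α by linarith) _ _ X.property h₃' _
      ext
      rw [hg', h0]
      exact zero_comp
    have hiso : IsIso f := (Simple.mono_isIso_iff_nonzero f).2
      (fun h => m₁ (congrArg (fun x => x.hom) h))
    have : IsIso T.mor₁ := inferInstanceAs (IsIso ((σ.P α).ι.map f))
    exact m₂ ((T.isZero₃_of_isIso₁ hT this).eq_of_tgt _ _)
  · subst hγ
    rw [add_sub_cancel_right] at h₃'
    -- Now `T.obj₃⟦-1⟧` itself lies in `P α`, and what its morphism to `T.obj₁` kills factors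
    -- through `T.obj₂⟦-1⟧`, of phase `α - 1`.
    let f : (⟨T.obj₃⟦(-1 : ℤ)⟧, h₃'⟩ : (σ.P α).FullSubcategory) ⟶ ⟨T.obj₁, h₁⟩ :=
      ⟨T.invRotate.mor₁⟩
    have hmono : Mono f := by
      refine Preadditive.mono_of_cancel_zero f fun {X} g hg => ?_
      have hg' : g.hom ≫ T.invRotate.mor₁ = 0 := congrArg (fun x => x.hom) hg
      obtain ⟨g', hg'⟩ := Triangle.coyoneda_exact₂ _ hT'' g.hom hg'
      have h0 : g' = 0 := σ.hom_eq_zero _ _ (show α - 1 < α by linarith) _ _ X.property h₂' _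
      ext
      rw [hg', h0]
      exact zero_comp
    have hne : T.invRotate.mor₁ ≠ 0 := fun h => m₃
      ((T.mor₃_eq_zero_iff_mono₁ hT).2 ((T.invRotate.mor₁_eq_zero_iff_mono₂ hT').1 h))
    have hiso : IsIso f := (Simple.mono_isIso_iff_nonzero f).2
      (fun h => hne (congrArg (fun x => x.hom) h))
    have : IsIso T.invRotate.mor₁ := inferInstanceAs (IsIso ((σ.P α).ι.map f))
    exact m₁ ((T.invRotate.isZero₃_of_isIso₁ hT' this).eq_of_tgt _ _)

end StabilityCondition

end StabilityGeneral

/-! ### From totally stable stability conditions to chord phases -/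

section TypeACategories

variable {D : Type u} [Category.{v} D] [HasZeroObject D] [HasShift D ℤ] [Preadditive D]
  [∀ n : ℤ, (shiftFunctor D n).Additive] [Pretriangulated D]

namespace StabilityCondition

variable {σ : StabilityCondition D}

lemma phase_unique {E : D} (hE : ¬ IsZero E) {α β : ℝ} (h₁ : σ.P α E) (h₂ : σ.P β E) : α = β := by
  rcases lt_trichotomy α β with h | h | h
  · exact absurd ((IsZero.iff_id_eq_zero E).2 (σ.hom_eq_zero _ _ h _ _ h₂ h₁ _)) hE
  · exact h
  · exact absurd ((IsZero.iff_id_eq_zero E).2 (σ.hom_eq_zero _ _ h _ _ h₁ h₂ _)) hE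

lemma IsTotallyStable.simple (hσ : σ.IsTotallyStable) {E : D} (hE : Indecomposable E) {α : ℝ}
    (h : σ.P α E) : Simple (⟨E, h⟩ : (σ.P α).FullSubcategory) := by
  obtain ⟨β, h', hs⟩ := hσ E hE
  obtain rfl := phase_unique hE.1 h h'
  exact hs

lemma IsTotallyStable.phase_lt (hσ : σ.IsTotallyStable) {T : Triangle D} (hT : T ∈ distTriang D)
    (i₁ : Indecomposable T.obj₁) (i₂ : Indecomposable T.obj₂) (i₃ : Indecomposable T.obj₃)
    {α β γ : ℝ} (h₁ : σ.P α T.obj₁) (h₂ : σ.P β T.obj₂) (h₃ : σ.P γ T.obj₃) : α < β :=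
  have ⟨m₁, m₂, m₃⟩ := mor_ne_zero_of_indecomposable hT i₁ i₂ i₃
  σ.phase_lt_of_triangle hT h₁ h₂ h₃ (hσ.simple i₁ h₁) (hσ.simple i₂ h₂) m₁ m₂ m₃

end StabilityCondition

/-- Pairs of a chord `a < b` of an `(n + 1)`-gon and an integral shift. -/
abbrev ChordShift (n : ℕ) : Type := {x : ℕ × ℕ // x.1 < x.2 ∧ x.2 ≤ n} × ℤ

/-- The shifts of a family of objects indexed by the chords. -/
def shiftedChord (n : ℕ) (M : ℕ → ℕ → D) (x : ChordShift n) : D := (M x.1.1.1 x.1.1.2)⟦x.2⟧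

lemma StabilityCondition.prop_shiftedChord (σ : StabilityCondition D) {n : ℕ} {M : ℕ → ℕ → D}
    {φ : ℕ → ℕ → ℝ}
    (hφ : ∀ {a b}, a < b → b ≤ n → σ.P (φ a b) (M a b)) (x : ChordShift n) :
    σ.P (φ x.1.1.1 x.1.1.2 + x.2) (shiftedChord n M x) :=
  (σ.prop_shift _ _ _).2 (hφ x.1.2.1 x.1.2.2)

/-- The structure of the bounded derived category of the linear quiver `A_n`, in terms of the
objects attached to the sides and diagonals of an `(n + 1)`-gon. -/
structure IsTypeA (n : ℕ) (M : ℕ → ℕ → D) : Prop where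
  triangle : ∀ {a b c}, a < b → b < c → c ≤ n →
    ∃ (f : M a b ⟶ M a c) (g : M a c ⟶ M b c) (h : M b c ⟶ (M a b)⟦(1 : ℤ)⟧),
      Triangle.mk f g h ∈ distTriang D
  not_isZero : ∀ {a b}, a < b → b ≤ n → ¬ IsZero (M a b)
  isIso_endo : ∀ {a b}, a < b → b ≤ n → ∀ f : M a b ⟶ M a b, f ≠ 0 → IsIso f
  hom_cases : ∀ {a b a' b'}, a < b → b ≤ n → a' < b' → b' ≤ n → ∀ (k : ℤ)
    (f : M a b ⟶ (M a' b')⟦k⟧), f ≠ 0 →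
    (k = 0 ∧ a ≤ a' ∧ a' < b ∧ b ≤ b') ∨ (k = 1 ∧ a' < a ∧ a ≤ b' ∧ b' < b)
  isDSum : ∀ E : D, IsDSum (shiftedChord n M) E
  -- These functionals are dual to the classes of the `M v (v + 1)`; they allow a central charge to
  -- be prescribed and a norm to be written down.
  exists_dim : ∃ d : ℕ → GrothendieckK D →+ ℤ, ∀ {a b}, a < b → b ≤ n → ∀ v < n,
    d v (kClass (M a b)) = if a ≤ v ∧ v < b then 1 else 0

namespace IsTypeA

variable {n : ℕ} {M : ℕ → ℕ → D} (hM : IsTypeA n M)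
include hM

lemma indecomposable {a b : ℕ} (hab : a < b) (hb : b ≤ n) : Indecomposable (M a b) :=
  indecomposable_of_isIso (hM.not_isZero hab hb) (hM.isIso_endo hab hb)

lemma shiftedChord_not_isZero (x : ChordShift n) : ¬ IsZero (shiftedChord n M x) := fun h => by
  refine hM.not_isZero x.1.2.1 x.1.2.2 ?_
  rw [IsZero.iff_id_eq_zero] at h ⊢
  apply (shiftFunctor D x.2).map_injective
  rw [CategoryTheory.Functor.map_id, Functor.map_zero]
  exact h

lemma shiftedChord_isIso_endo (x : ChordShift n) (f : shiftedChord n M x ⟶ shiftedChord n M x)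
    (hf : f ≠ 0) : IsIso f := by
  obtain ⟨g, rfl⟩ : ∃ g, (shiftFunctor D x.2).map g = f := (shiftFunctor D x.2).map_surjective f
  have : IsIso g := hM.isIso_endo x.1.2.1 x.1.2.2 g fun h =>
    hf ((congrArg _ h).trans (Functor.map_zero _ _ _))
  exact inferInstanceAs (IsIso ((shiftFunctor D x.2).map g))

lemma shiftedChord_indecomposable (x : ChordShift n) : Indecomposable (shiftedChord n M x) :=
  indecomposable_of_isIso (hM.shiftedChord_not_isZero x) (hM.shiftedChord_isIso_endo x)

lemma kClass_add {a b c : ℕ} (hab : a < b) (hbc : b < c) (hc : c ≤ n) :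
    kClass (M a c) = kClass (M a b) + kClass (M b c) := by
  obtain ⟨f, g, h, hT⟩ := hM.triangle hab hbc hc
  exact kClass_triangle hT

lemma hom_ext_of_chords {G : Type*} [AddCommGroup G] {f g : GrothendieckK D →+ G}
    (h : ∀ a b, a < b → b ≤ n → f (kClass (M a b)) = g (kClass (M a b))) : f = g := by
  refine kClass_dsum_ext hM.isDSum fun x => ?_
  rw [shiftedChord, kClass_shift, map_zsmul, map_zsmul, h _ _ x.1.2.1 x.1.2.2]

lemma hom_ext_of_simples {G : Type*} [AddCommGroup G] {f g : GrothendieckK D →+ G}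
    (h : ∀ v < n, f (kClass (M v (v + 1))) = g (kClass (M v (v + 1)))) : f = g := by
  refine hM.hom_ext_of_chords fun a b hab hb => ?_
  induction b with
  | zero => omega
  | succ b ih =>
    obtain rfl | hlt : a = b ∨ a < b := by omega
    · exact h a (by omega)
    · rw [hM.kClass_add hlt (Nat.lt_succ_self b) hb, map_add, map_add, ih hlt (by omega),
        h b (by omega)]

end IsTypeA

/-- The vertices of the polygon with sides the central charges of the simple modules. -/
def chargeVertex (M : ℕ → ℕ → D) (Z : GrothendieckK D →+ ℂ) (b : ℕ) : ℂ :=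
  if b = 0 then 0 else Z (kClass (M 0 b))

namespace IsTypeA

variable {n : ℕ} {M : ℕ → ℕ → D} (hM : IsTypeA n M)
include hM

lemma charge_eq (Z : GrothendieckK D →+ ℂ) {a b : ℕ} (hab : a < b) (hb : b ≤ n) :
    Z (kClass (M a b)) = chargeVertex M Z b - chargeVertex M Z a := by
  unfold chargeVertex
  obtain rfl | ha : a = 0 ∨ 0 < a := by omega
  · simp [show b ≠ 0 by omega]
  · rw [if_neg (by omega), if_neg (by omega), hM.kClass_add ha hab hb, map_add,
      add_sub_cancel_left]

/-- The phases of the chord objects for a totally stable stability condition. -/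
lemma exists_chordPhases {σ : StabilityCondition D} (hσ : σ.IsTotallyStable) :
    ∃ φ : ℕ → ℕ → ℝ, (∀ {a b}, a < b → b ≤ n → σ.P (φ a b) (M a b)) ∧
      ChordPhases n (chargeVertex M σ.Z) φ := by
  have h : ∀ a b, ∃ φ : ℝ, a < b → b ≤ n → σ.P φ (M a b) := by
    intro a b
    by_cases hab : a < b ∧ b ≤ n
    · obtain ⟨φ, h, -⟩ := hσ _ (hM.indecomposable hab.1 hab.2)
      exact ⟨φ, fun _ _ => h⟩
    · exact ⟨0, fun h1 h2 => absurd ⟨h1, h2⟩ hab⟩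
  choose φ hφ using h
  have hφ' : ∀ {a b}, a < b → b ≤ n → σ.P (φ a b + 1) ((M a b)⟦(1 : ℤ)⟧) :=
    fun h1 h2 => (σ.shift _ _).2 (hφ _ _ h1 h2)
  have hI : ∀ {a b}, a < b → b ≤ n → Indecomposable (M a b) := fun h1 h2 => hM.indecomposable h1 h2
  have hI' : ∀ {a b}, a < b → b ≤ n → Indecomposable ((M a b)⟦(1 : ℤ)⟧) := fun h1 h2 =>
    hM.shiftedChord_indecomposable ⟨⟨(_, _), h1, h2⟩, 1⟩
  refine ⟨φ, fun h1 h2 => hφ _ _ h1 h2, fun {a b} h1 h2 => ?_, fun {a b c} hab hbc hc => ?_,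
    fun {a b c} hab hbc hc => ?_, fun {a b c} hab hbc hc => ?_⟩
  · rw [← hM.charge_eq _ h1 h2]
    exact σ.ray _ _ (hφ _ _ h1 h2) (hM.not_isZero h1 h2)
  -- The three inequalities come from one triangle and its two rotations.
  all_goals
    have hac := hab.trans hbc
    have hb := hbc.le.trans hc
    obtain ⟨f, g, h, hT⟩ := hM.triangle hab hbc hc
  · exact hσ.phase_lt hT (hI hab hb) (hI hac hc) (hI hbc hc)
      (hφ _ _ hab hb) (hφ _ _ hac hc) (hφ _ _ hbc hc)
  · exact hσ.phase_lt (rot_of_distTriang _ hT) (hI hac hc) (hI hbc hc) (hI' hab hb)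
      (hφ _ _ hac hc) (hφ _ _ hbc hc) (hφ' hab hb)
  · exact hσ.phase_lt (rot_of_distTriang _ (rot_of_distTriang _ hT)) (hI hbc hc) (hI' hab hb)
      (hI' hac hc) (hφ _ _ hbc hc) (hφ' hab hb) (hφ' hac hc)

/-- A summand of an object of `σ.P ψ` maps to it and back nontrivially, so Hom-vanishing forces the
summand to have phase `ψ`. Hence the slices are determined by the phases of the chord objects. -/
lemma prop_le {σ τ : StabilityCondition D} {φ : ℕ → ℕ → ℝ}
    (hσ : ∀ {a b}, a < b → b ≤ n → σ.P (φ a b) (M a b))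
    (hτ : ∀ {a b}, a < b → b ≤ n → τ.P (φ a b) (M a b)) {ψ : ℝ} {E : D} (hE : σ.P ψ E) :
    τ.P ψ E := by
  obtain ⟨L, ⟨e⟩⟩ := hM.isDSum E
  refine (τ.P ψ).prop_of_iso e.symm (τ.prop_dsum fun x hx => ?_)
  obtain ⟨s, r, hsr⟩ := dsum_retract (X := shiftedChord n M) hx
  have hL : σ.P ψ (dsum (shiftedChord n M) L) := (σ.P ψ).prop_of_iso e hE
  have hx' := σ.prop_shiftedChord hσ x
  have h0 : ¬ (s ≫ r = 0) := by
    rw [hsr, ← IsZero.iff_id_eq_zero]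
    exact hM.shiftedChord_not_isZero x
  have : φ x.1.1.1 x.1.1.2 + x.2 = ψ := by
    rcases lt_trichotomy (φ x.1.1.1 x.1.1.2 + x.2) ψ with h | h | h
    · exact absurd (by rw [σ.hom_eq_zero _ _ h _ _ hL hx' r, Limits.comp_zero]) h0
    · exact h
    · exact absurd (by rw [σ.hom_eq_zero _ _ h _ _ hx' hL s, Limits.zero_comp]) h0
  rw [← this]
  exact τ.prop_shiftedChord hτ x

lemma stabilityCondition_ext {σ τ : StabilityCondition D} {φ : ℕ → ℕ → ℝ}
    (hσ : ∀ {a b}, a < b → b ≤ n → σ.P (φ a b) (M a b))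
    (hτ : ∀ {a b}, a < b → b ≤ n → τ.P (φ a b) (M a b))
    (hZ : ∀ b, 0 < b → b ≤ n → σ.Z (kClass (M 0 b)) = τ.Z (kClass (M 0 b))) : σ = τ := by
  apply StabilityCondition.ext
  · refine hM.hom_ext_of_chords fun a b hab hb => ?_
    rw [hM.charge_eq _ hab hb, hM.charge_eq _ hab hb]
    have : ∀ b ≤ n, chargeVertex M σ.Z b = chargeVertex M τ.Z b := fun b hb => by
      unfold chargeVertex
      split_ifs with h
      · rfl
      · exact hZ b (by omega) hb
    rw [this b hb, this a (by omega)]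
  · funext ψ E
    exact propext ⟨hM.prop_le hσ hτ, hM.prop_le hτ hσ⟩

/-- Totally stable stability conditions with similar polygons lie in the same orbit. -/
lemma exists_vadd_eq (hn : 0 < n) {σ τ : StabilityCondition D} (hσ : σ.IsTotallyStable)
    (hτ : τ.IsTotallyStable)
    (h : ∀ b, 0 < b → b ≤ n → σ.Z (kClass (M 0 b)) / σ.Z (kClass (M 0 1)) =
      τ.Z (kClass (M 0 b)) / τ.Z (kClass (M 0 1))) : ∃ s : ℂ, s +ᵥ σ = τ := by
  obtain ⟨φ, hφ, hcφ⟩ := hM.exists_chordPhases hσ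
  obtain ⟨ψ, hψ, hcψ⟩ := hM.exists_chordPhases hτ
  have hz := σ.ray _ _ (hφ one_pos hn) (hM.not_isZero one_pos hn)
  have hw := τ.ray _ _ (hψ one_pos hn) (hM.not_isZero one_pos hn)
  set z := σ.Z (kClass (M 0 1)) with hz_def
  set w := τ.Z (kClass (M 0 1)) with hw_def
  have hz0 : z ≠ 0 := IsPhase.ne_zero hz
  have hw0 : w ≠ 0 := IsPhase.ne_zero hw
  obtain ⟨x, hx, hzx⟩ := hz
  obtain ⟨y, hy, hwy⟩ := hw
  -- The real part aligns the phases of `M 0 1`; the imaginary part rescales its central charge by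
  -- `y / x`.
  let s : ℂ := ⟨φ 0 1 - ψ 0 1, Real.log (y / x) / Real.pi⟩
  have hs : z * Complex.exp (-(Complex.I * Real.pi * s)) = w := by
    have h1 : Complex.exp (-(Complex.I * Real.pi * s)) = ((y / x : ℝ) : ℂ) *
        Complex.exp (Complex.I * Real.pi * ψ 0 1 - Complex.I * Real.pi * φ 0 1) := by
      rw [← Real.exp_log (div_pos hy hx), Complex.ofReal_exp, ← Complex.exp_add]
      congr 1
      have : Real.pi ≠ 0 := Real.pi_ne_zero
      apply Complex.ext
      · simp [s]
        field_simp
      · simp [s]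
        ring
    rw [h1, Complex.exp_sub, hzx, hwy]
    have : (x : ℂ) ≠ 0 := by exact_mod_cast hx.ne'
    have := Complex.exp_ne_zero (Complex.I * Real.pi * φ 0 1)
    push_cast
    field_simp
  have hZ : ∀ b, 0 < b → b ≤ n → (s +ᵥ σ).Z (kClass (M 0 b)) = τ.Z (kClass (M 0 b)) := by
    intro b hb0 hb
    have := h b hb0 hb
    change σ.Z (kClass (M 0 b)) * Complex.exp (-(Complex.I * Real.pi * s)) = _
    rw [div_eq_div_iff hz0 hw0, ← hs] at this
    apply mul_left_cancel₀ hz0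
    linear_combination this
  obtain ⟨χ, hχ, hcχ⟩ := hM.exists_chordPhases
    (StabilityCondition.isTotallyStable_translate s σ hσ)
  have hχ01 : χ 0 1 = ψ 0 1 := by
    have h1 : σ.P (χ 0 1 + s.re) (M 0 1) := hχ one_pos hn
    have := StabilityCondition.phase_unique (hM.not_isZero one_pos hn) h1 (hφ one_pos hn)
    have h2 : s.re = φ 0 1 - ψ 0 1 := rfl
    linarith
  -- The two vertex sequences are only known to agree up to index `n`; this suffices to read `ψ` as
  -- phases for the polygon of the translate.
  have hp : chargeVertex M (σ.translate s).Z = fun b => if b ≤ n then chargeVertex M τ.Z b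
    else chargeVertex M (σ.translate s).Z b := by
    funext b
    split_ifs with hb
    · unfold chargeVertex
      split_ifs with h0
      · rfl
      · exact hZ b (by omega) hb
    · rfl
  refine ⟨s, hM.stabilityCondition_ext (φ := χ) hχ (fun {a b} hab hb => ?_) hZ⟩
  have := ChordPhases.eq hcχ (p := chargeVertex M (σ.translate s).Z) (φ' := ψ) ?_ hχ01 hab hb
  · rw [this]
    exact hψ hab hb
  · refine ⟨fun {a b} h1 h2 => ?_, hcψ.lt₁, hcψ.lt₂, hcψ.lt₃⟩
    rw [hp]
    simp only [h2, h1.le.trans h2, if_true]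
    exact hcψ.isPhase h1 h2

end IsTypeA
end TypeACategories

/-! ### From chord phases to totally stable stability conditions -/

section PhasedFamilies

variable {D : Type u} [Category.{v} D] [HasZeroObject D] [HasShift D ℤ] [Preadditive D]
  [∀ n : ℤ, (shiftFunctor D n).Additive] [Pretriangulated D]

/-- The objects which are finite direct sums of members of phase `ψ` of a family. -/
def phaseProp {ι : Type*} (X : ι → D) (ph : ι → ℝ) (ψ : ℝ) : ObjectProperty D := fun E =>
  ∃ L : List ι, (∀ x ∈ L, ph x = ψ) ∧ Nonempty (E ≅ dsum X L)

section

variable {ι : Type*} (X : ι → D) (ph : ι → ℝ)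

instance (ψ : ℝ) : (phaseProp X ph ψ).IsClosedUnderIsomorphisms where
  of_iso := by
    rintro E E' e ⟨L, hL, ⟨e'⟩⟩
    exact ⟨L, hL, ⟨e.symm ≪≫ e'⟩⟩

lemma phaseProp_single (x : ι) : phaseProp X ph (ph x) (X x) :=
  ⟨[x], by simp, ⟨biprodIsoOfIsZeroRight (dsum_nil X)⟩⟩

lemma phaseProp_isClosedUnderFiniteProducts (ψ : ℝ) :
    (phaseProp X ph ψ).IsClosedUnderFiniteProducts := by
  have h0 : (phaseProp X ph ψ).IsClosedUnderLimitsOfShape (Discrete.{0} PEmpty) := by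
    have : (phaseProp X ph ψ).ContainsZero := ⟨⟨_, dsum_nil X, [], by simp, ⟨Iso.refl _⟩⟩⟩
    infer_instance
  have h2 : (phaseProp X ph ψ).IsClosedUnderBinaryProducts := by
    refine .mk' ?_
    rintro _ ⟨F, hF⟩
    obtain ⟨L, hL, ⟨e⟩⟩ := hF ⟨WalkingPair.left⟩
    obtain ⟨L', hL', ⟨e'⟩⟩ := hF ⟨WalkingPair.right⟩
    refine ⟨L ++ L', fun x hx => ?_, ⟨?_⟩⟩
    · rcases List.mem_append.1 hx with hx | hx
      exacts [hL x hx, hL' x hx]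
    · exact HasLimit.isoOfNatIso (diagramIsoPair F) ≪≫ (biprod.isoProd _ _).symm ≪≫
        biprod.mapIso e e' ≪≫ (dsum_append X L L').some.symm
  exact .mk'

/-- Decomposition by phases yields Harder–Narasimhan filtrations. -/
lemma exists_filtration (L : List ι) :
    ∃ (l : ℕ) (φ : Fin l → ℝ) (F : Fin (l + 1) → D) (A : Fin l → D),
      StrictAnti φ ∧ IsZero (F 0) ∧ Nonempty (F (Fin.last l) ≅ dsum X L) ∧
      (∀ i, ∃ x ∈ L, φ i = ph x) ∧ ∀ i : Fin l, phaseProp X ph (φ i) (A i) ∧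
      ∃ (f : F i.castSucc ⟶ F i.succ) (g : F i.succ ⟶ A i) (h : A i ⟶ (F i.castSucc)⟦(1 : ℤ)⟧),
        Triangle.mk f g h ∈ distTriang D := by
  classical
  induction hN : L.length using Nat.strong_induction_on generalizing L with
  | _ N ih =>
  by_cases hL : L = []
  · subst hL
    exact ⟨0, Fin.elim0, fun _ => dsum X [], Fin.elim0, fun i => i.elim0, dsum_nil X,
      ⟨Iso.refl _⟩, fun i => i.elim0, fun i => i.elim0⟩
  -- The last Harder–Narasimhan factor has the smallest phase, so the summands of minimal phase are
  -- split off and the remaining ones are filtered recursively.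
  obtain ⟨x₀, hx₀, hmin⟩ : ∃ x ∈ L, ∀ y ∈ L, ph x ≤ ph y := by
    obtain ⟨x, hx, h⟩ := L.toFinset.exists_min_image ph (List.toFinset_nonempty_iff L |>.2 hL)
    exact ⟨x, by simpa using hx, fun y hy => h y (by simpa using hy)⟩
  obtain ⟨e⟩ := dsum_filter X (fun x => decide (ph x ≠ ph x₀)) L
  set L₁ := L.filter fun x => decide (ph x ≠ ph x₀) with hL₁
  set L₂ := L.filter fun x => !decide (ph x ≠ ph x₀) with hL₂
  have hlen : L₁.length < N := by
    rw [← hN]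
    exact List.length_filter_lt_length_iff_exists.2 ⟨x₀, hx₀, by simp⟩
  obtain ⟨l, φ, F, A, hφ, hF0, ⟨eF⟩, hφL, hA⟩ := ih _ hlen L₁ rfl
  have hlast : ∃ (f : F (Fin.last l) ⟶ dsum X L) (g : dsum X L ⟶ dsum X L₂)
      (h : dsum X L₂ ⟶ (F (Fin.last l))⟦(1 : ℤ)⟧), Triangle.mk f g h ∈ distTriang D := by
    refine ⟨eF.hom ≫ biprod.inl ≫ e.inv, e.hom ≫ biprod.snd, 0,
      isomorphic_distinguished _ (binaryBiproductTriangle_distinguished (dsum X L₁) (dsum X L₂)) _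
        (Triangle.isoMk _ _ eF e (Iso.refl _) ?_ ?_ ?_)⟩
    · have : (eF.hom ≫ biprod.inl ≫ e.inv) ≫ e.hom = eF.hom ≫ biprod.inl := by simp
      exact this
    · exact Category.comp_id _
    · exact Limits.zero_comp.trans Limits.comp_zero.symm
  have hφx : ∀ i, ph x₀ < φ i := fun i => by
    obtain ⟨x, hx, h⟩ := hφL i
    rw [h]
    rw [hL₁, List.mem_filter] at hx
    exact lt_of_le_of_ne (hmin x hx.1) fun h => by simp [h] at hx
  refine ⟨l + 1, Fin.snoc (α := fun _ => ℝ) φ (ph x₀), Fin.snoc (α := fun _ => D) F (dsum X L),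
    Fin.snoc (α := fun _ => D) A (dsum X L₂), ?_, ?_, ?_, ?_, ?_⟩
  · intro i j hij
    induction j using Fin.lastCases with
    | last =>
      induction i using Fin.lastCases with
      | last => exact absurd hij (lt_irrefl _)
      | cast i => simpa using hφx i
    | cast j =>
      induction i using Fin.lastCases with
      | last => exact absurd hij (not_lt.2 (Fin.le_last _))
      | cast i => simpa using hφ (by simpa using hij)
  · rw [← Fin.castSucc_zero, Fin.snoc_castSucc]
    exact hF0
  · rw [Fin.snoc_last]
    exact ⟨Iso.refl _⟩
  · intro i
    induction i using Fin.lastCases with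
    | last => exact ⟨x₀, hx₀, by simp⟩
    | cast i =>
      obtain ⟨x, hx, h⟩ := hφL i
      exact ⟨x, (List.mem_filter.1 hx).1, by simpa using h⟩
  · intro i
    induction i using Fin.lastCases with
    | last =>
      rw [Fin.succ_last, Fin.snoc_last, Fin.snoc_last, Fin.snoc_last, Fin.snoc_castSucc]
      refine ⟨⟨L₂, fun x hx => ?_, ⟨Iso.refl _⟩⟩, hlast⟩
      rw [hL₂, List.mem_filter] at hx
      simpa using hx.2
    | cast i =>
      rw [Fin.succ_castSucc, Fin.snoc_castSucc, Fin.snoc_castSucc, Fin.snoc_castSucc,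
        Fin.snoc_castSucc]
      exact hA i

variable {X ph} in
lemma phaseProp_shift {k : ℤ}
    (hshift : ∀ x, ∃ y, ph y = ph x + k ∧ Nonempty ((X x)⟦k⟧ ≅ X y)) {ψ : ℝ} {E : D}
    (hE : phaseProp X ph ψ E) : phaseProp X ph (ψ + k) (E⟦k⟧) := by
  obtain ⟨L, hL, ⟨e⟩⟩ := hE
  choose σ hσ hσ' using hshift
  refine ⟨L.map σ, ?_, ⟨(shiftFunctor D k).mapIso e ≪≫
    (dsum_map (shiftFunctor D k) hσ' L).some⟩⟩
  simp only [List.mem_map, forall_exists_index, and_imp, forall_apply_eq_imp_iff₂]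
  exact fun x hx => by rw [hσ, hL x hx]

end

/-- A family of objects with phases such that nonzero morphisms do not decrease the phases, and
whose sums exhaust the category, defines a stability condition. -/
theorem exists_stabilityCondition_of_phases {ι : Type*} (X : ι → D) (ph : ι → ℝ)
    (Z : GrothendieckK D →+ ℂ) (hX : ∀ E, IsDSum X E)
    (hhom : ∀ x y (f : X x ⟶ X y), f ≠ 0 → ph x ≤ ph y)
    (hZ : ∀ x, IsPhase (Z (kClass (X x))) (ph x))
    (hshift : ∀ (k : ℤ) x, ∃ y, ph y = ph x + k ∧ Nonempty ((X x)⟦k⟧ ≅ X y))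
    (N : Seminorm ℝ (ℝ ⊗[ℤ] GrothendieckK D)) (hN : ∀ x, N x = 0 → x = 0) (C : ℝ)
    (hC : ∀ x, N ((1 : ℝ) ⊗ₜ[ℤ] kClass (X x)) ≤ C * ‖Z (kClass (X x))‖) :
    ∃ σ : StabilityCondition D, σ.Z = Z ∧ σ.P = phaseProp X ph := by
  -- Central charges of equal phase lie on one ray, so their absolute values add, and the norm bound
  -- passes from the family to sums.
  have key : ∀ ψ (E : D), phaseProp X ph ψ E → ¬ IsZero E → IsPhase (Z (kClass E)) ψ ∧
      N ((1 : ℝ) ⊗ₜ[ℤ] kClass E) ≤ C * ‖Z (kClass E)‖ := by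
    rintro ψ E ⟨L, hL, ⟨e⟩⟩ hE
    rw [kClass_iso e]
    replace hE : ¬ IsZero (dsum X L) := fun h => hE (h.of_iso e)
    clear e
    induction L with
    | nil => exact absurd (dsum_nil X) hE
    | cons x L ih =>
      rw [kClass_iso (dsumCons X x L), kClass_biprod]
      have hx := hZ x
      rw [hL x (by simp)] at hx
      by_cases h0 : IsZero (dsum X L)
      · rw [kClass_of_isZero h0, add_zero]
        exact ⟨hx, hC x⟩
      · obtain ⟨h1, h2⟩ := ih (fun y hy => hL y (by simp [hy])) h0
        obtain ⟨h3, h4⟩ := hx.add h1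
        rw [map_add]
        refine ⟨h3, ?_⟩
        rw [h4, TensorProduct.tmul_add]
        linarith [map_add_le_add N ((1 : ℝ) ⊗ₜ[ℤ] kClass (X x))
          ((1 : ℝ) ⊗ₜ[ℤ] kClass (dsum X L)), hC x]
  refine ⟨{
    Z := Z
    P := phaseProp X ph
    replete := fun φ => inferInstance
    additive := phaseProp_isClosedUnderFiniteProducts X ph
    ray := fun φ E h h0 => (key φ E h h0).1
    shift := fun φ E => ⟨fun h => ?_, fun h => ?_⟩
    hom_eq_zero := ?_
    hn := ?_
    support := ?_ }, rfl, rfl⟩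
  · have := phaseProp_shift (hshift (-1)) h
    push_cast at this
    rw [add_neg_cancel_right] at this
    exact (phaseProp X ph φ).prop_of_iso (shiftShiftNeg E (1 : ℤ)) this
  · have := phaseProp_shift (hshift 1) h
    push_cast at this
    exact this
  · rintro φ₁ φ₂ h A₁ A₂ ⟨L₁, h₁, ⟨e₁⟩⟩ ⟨L₂, h₂, ⟨e₂⟩⟩ f
    have : e₁.inv ≫ f ≫ e₂.hom = 0 := by
      refine dsum_hom_eq_zero (fun y hy g => hom_dsum_eq_zero (fun x hx g => ?_) g) _
      by_contra hg
      have := hhom x y g hg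
      rw [h₁ x hx, h₂ y hy] at this
      linarith
    rw [← cancel_epi e₁.inv, ← cancel_mono e₂.hom, Category.assoc, this]
    simp
  · intro E hE
    obtain ⟨L, ⟨e⟩⟩ := hX E
    obtain ⟨l, φ, F, A, h1, h2, ⟨e'⟩, -, h⟩ := exists_filtration X ph L
    exact ⟨l, φ, F, A, h1, h2, ⟨e' ≪≫ e.symm⟩, h⟩
  -- `C` need not be positive and gives only a weak inequality; `|C| + 1` repairs both.
  · refine ⟨N, hN, |C| + 1, by positivity, fun φ E h h0 => ?_⟩
    obtain ⟨h1, h2⟩ := key φ E h h0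
    have : 0 < ‖Z (kClass E)‖ := norm_pos_iff.2 h1.ne_zero
    nlinarith [le_abs_self C]

/-- If moreover nonzero morphisms preserving the phase are isomorphisms, then the members of the
family are stable. -/
lemma simple_of_phaseProp {ι : Type*} {X : ι → D} {ph : ι → ℝ}
    (hiso : ∀ x y (f : X x ⟶ X y), f ≠ 0 → ph x = ph y → IsIso f) (x : ι)
    (h0 : ¬ IsZero (X x)) (h : phaseProp X ph (ph x) (X x)) :
    Simple (⟨X x, h⟩ : (phaseProp X ph (ph x)).FullSubcategory) := by
  refine ⟨fun {Y} f _ => ⟨fun _ hf => h0 ?_, fun hf => ?_⟩⟩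
  · have : IsIso f.hom := inferInstanceAs (IsIso ((phaseProp X ph (ph x)).ι.map f))
    rw [IsZero.iff_id_eq_zero, ← IsIso.inv_hom_id f.hom]
    have h0 : f.hom = 0 := congrArg (fun g => g.hom) hf
    rw [show inv f.hom ≫ f.hom = inv f.hom ≫ 0 from congrArg _ h0, Limits.comp_zero]
  · obtain ⟨L, hL, ⟨e⟩⟩ := Y.property
    have hf' : e.inv ≫ f.hom ≠ 0 := fun h => hf <| by
      ext
      rw [← cancel_epi e.inv, h]
      exact Limits.comp_zero.symm
    -- Some summand of `Y` maps nontrivially to `X x`; having the same phase it maps isomorphically,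
    -- which splits the monomorphism `f`.
    obtain ⟨y, hy, s, hs⟩ := exists_comp_ne_zero hf'
    have := hiso _ _ _ hs (hL y hy)
    let g : (⟨X x, h⟩ : (phaseProp X ph (ph x)).FullSubcategory) ⟶ Y :=
      ⟨inv (s ≫ e.inv ≫ f.hom) ≫ s ≫ e.inv⟩
    have hg : g ≫ f = 𝟙 _ := by
      ext
      change (inv (s ≫ e.inv ≫ f.hom) ≫ s ≫ e.inv) ≫ f.hom = 𝟙 _
      simp
    have : IsSplitEpi f := ⟨⟨⟨g, hg⟩⟩⟩
    exact isIso_of_mono_of_isSplitEpi f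

namespace IsTypeA

variable {n : ℕ} {M : ℕ → ℕ → D} (hM : IsTypeA n M)
include hM

/-- After removing a common shift only degrees zero and one occur. In degree zero the endpoints of
the chord move forward, which raises the phase unless neither moves; in degree one `lt₃` shows that
the extra `1` outweighs moving backward. -/
lemma phase_le_of_hom {p : ℕ → ℂ} {φ : ℕ → ℕ → ℝ} (hφ : ChordPhases n p φ) (x y : ChordShift n)
    (f : shiftedChord n M x ⟶ shiftedChord n M y) (hf : f ≠ 0) :
    φ x.1.1.1 x.1.1.2 + x.2 ≤ φ y.1.1.1 y.1.1.2 + y.2 ∧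
      (φ x.1.1.1 x.1.1.2 + x.2 = φ y.1.1.1 y.1.1.2 + y.2 → x = y) := by
  obtain ⟨⟨⟨a, b⟩, hab, hb⟩, k⟩ := x
  obtain ⟨⟨⟨a', b'⟩, hab', hb'⟩, k'⟩ := y
  dsimp only at hab hb hab' hb' ⊢
  let e : (M a' b')⟦k'⟧ ≅ ((M a' b')⟦k' - k⟧)⟦k⟧ :=
    (shiftFunctorAdd' D (k' - k) k k' (by omega)).app _
  obtain ⟨g, hg⟩ : ∃ g : M a b ⟶ (M a' b')⟦k' - k⟧, (shiftFunctor D k).map g = f ≫ e.hom :=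
    (shiftFunctor D k).map_surjective _
  have hg0 : g ≠ 0 := by
    rintro rfl
    rw [Functor.map_zero] at hg
    exact hf ((cancel_mono e.hom).1 (hg.symm.trans Limits.zero_comp.symm))
  rcases hM.hom_cases hab hb hab' hb' _ g hg0 with ⟨h0, h1, h2, h3⟩ | ⟨h0, h1, h2, h3⟩
  · obtain rfl : k' = k := by omega
    rcases h1.eq_or_lt with rfl | h1
    · rcases h3.eq_or_lt with rfl | h3
      · exact ⟨le_rfl, fun _ => rfl⟩
      · have := hφ.lt₁ hab h3 hb'
        exact ⟨by linarith, fun h => by linarith⟩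
    · have l1 := hφ.lt₂ h1 h2 hb
      rcases h3.eq_or_lt with rfl | h3
      · exact ⟨by linarith, fun h => by linarith⟩
      · have := hφ.lt₁ h2 h3 hb'
        exact ⟨by linarith, fun h => by linarith⟩
  · obtain rfl : k' = k + 1 := by omega
    push_cast
    have l1 := hφ.lt₃ hab' h3 hb
    rcases h2.eq_or_lt with rfl | h2
    · exact ⟨by linarith, fun h => by linarith⟩
    · have := hφ.lt₂ h2 h3 hb
      exact ⟨by linarith, fun h => by linarith⟩

/-- The dimension functionals, weighted by the sides `p (v + 1) - p v`, give the charge; the values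
on longer chords telescope. -/
lemma exists_charge (p : ℕ → ℂ) :
    ∃ Z : GrothendieckK D →+ ℂ, ∀ {a b}, a < b → b ≤ n → Z (kClass (M a b)) = p b - p a := by
  obtain ⟨d, hd⟩ := hM.exists_dim
  let Z : GrothendieckK D →+ ℂ := ∑ v ∈ Finset.range n,
    (AddMonoidHom.mulRight (p (v + 1) - p v)).comp ((Int.castAddHom ℂ).comp (d v))
  have h1 : ∀ v < n, Z (kClass (M v (v + 1))) = p (v + 1) - p v := fun v hv => by
    simp only [Z, AddMonoidHom.finsetSum_apply, AddMonoidHom.comp_apply,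
      AddMonoidHom.coe_mulRight, Int.coe_castAddHom]
    rw [Finset.sum_eq_single v]
    · rw [hd (by omega) (by omega) v hv]
      simp
    · intro w hw hwv
      rw [hd (by omega) (by omega) w (Finset.mem_range.1 hw), if_neg (by omega)]
      simp
    · intro h
      exact absurd (Finset.mem_range.2 hv) h
  refine ⟨Z, fun {a b} hab hb => ?_⟩
  induction b with
  | zero => omega
  | succ b ih =>
    obtain rfl | hlt : a = b ∨ a < b := by omega
    · exact h1 a (by omega)
    · rw [hM.kClass_add hlt (Nat.lt_succ_self b) hb, map_add, ih hlt (by omega), h1 b (by omega)]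
      ring

/-- The dimension functionals are coordinates with respect to the classes of the `M v (v + 1)`. The
sup norm of these coordinates works, since those of a shifted chord object are `0` or `±1`. -/
lemma exists_norm : ∃ N : Seminorm ℝ (ℝ ⊗[ℤ] GrothendieckK D), (∀ x, N x = 0 → x = 0) ∧
    ∀ x : ChordShift n, N ((1 : ℝ) ⊗ₜ[ℤ] kClass (shiftedChord n M x)) ≤ 1 := by
  obtain ⟨d, hd⟩ := hM.exists_dim
  let D' : Fin n → (ℝ ⊗[ℤ] GrothendieckK D) →ₗ[ℝ] ℝ := fun v =>
    (TensorProduct.AlgebraTensorModule.rid ℤ ℝ ℝ).toLinearMap ∘ₗ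
      (d v).toIntLinearMap.baseChange ℝ
  have hD' : ∀ v r x, D' v (r ⊗ₜ[ℤ] x) = r * d v x := fun v r x => by
    simp [D', mul_comm]
  have hid : ∀ x : GrothendieckK D, x = ∑ v : Fin n, d v x • kClass (M v (v + 1)) := by
    let f : GrothendieckK D →+ GrothendieckK D :=
      ∑ v : Fin n, ((smulAddHom ℤ (GrothendieckK D)).flip (kClass (M v (v + 1)))).comp (d v)
    have : AddMonoidHom.id _ = f := by
      refine hM.hom_ext_of_simples fun v hv => ?_
      simp only [f, AddMonoidHom.id_apply, AddMonoidHom.finsetSum_apply, AddMonoidHom.comp_apply,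
        AddMonoidHom.flip_apply, smulAddHom_apply]
      rw [Finset.sum_eq_single ⟨v, hv⟩]
      · rw [hd (by omega) (by omega) v hv]
        simp
      · intro w _ hwv
        have : w.val ≠ v := fun h => hwv (Fin.ext h)
        rw [hd (by omega) (by omega) w w.2, if_neg (by omega), zero_smul]
      · simp
    intro x
    have hx := DFunLike.congr_fun this x
    simpa [f] using hx
  have hdef : ∀ x, x = ∑ v : Fin n, D' v x • ((1 : ℝ) ⊗ₜ[ℤ] kClass (M v (v + 1))) := fun x => by
    induction x using TensorProduct.induction_on with
    | zero => simp
    | tmul r c =>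
      conv_lhs => rw [hid c, TensorProduct.tmul_sum]
      refine Finset.sum_congr rfl fun v _ => ?_
      rw [hD', TensorProduct.smul_tmul', TensorProduct.tmul_smul, TensorProduct.smul_tmul']
      simp [mul_comm]
    | add x y hx hy =>
      conv_lhs => rw [hx, hy]
      simp only [map_add, add_smul, Finset.sum_add_distrib]
  refine ⟨(normSeminorm ℝ (Fin n → ℝ)).comp (LinearMap.pi D'), fun x hx => ?_, fun x => ?_⟩
  · have : LinearMap.pi D' x = 0 := norm_eq_zero.1 hx
    rw [hdef x]
    refine Finset.sum_eq_zero fun v _ => ?_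
    rw [show D' v x = 0 from congrFun this v, zero_smul]
  · change ‖LinearMap.pi D' _‖ ≤ 1
    rw [pi_norm_le_iff_of_nonneg zero_le_one]
    intro v
    rw [LinearMap.pi_apply, hD', shiftedChord, kClass_shift, map_zsmul, hd x.1.2.1 x.1.2.2 v v.2]
    split_ifs <;> rcases Int.units_eq_one_or x.2.negOnePow with h | h <;> simp [h]

/-- A convex polygon with compatible phases comes from a totally stable stability condition. -/
theorem exists_stabilityCondition {p : ℕ → ℂ} {φ : ℕ → ℕ → ℝ} (hφ : ChordPhases n p φ) :
    ∃ σ : StabilityCondition D, σ.IsTotallyStable ∧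
      ∀ {a b}, a < b → b ≤ n → σ.Z (kClass (M a b)) = p b - p a := by
  obtain ⟨Z, hZ⟩ := hM.exists_charge p
  obtain ⟨N, hN, hN1⟩ := hM.exists_norm
  let ph : ChordShift n → ℝ := fun x => φ x.1.1.1 x.1.1.2 + x.2
  have hph : ∀ x : ChordShift n, IsPhase (Z (kClass (shiftedChord n M x))) (ph x) := fun x => by
    have h1 := hφ.isPhase x.1.2.1 x.1.2.2
    rw [shiftedChord, kClass_shift, map_zsmul, hZ x.1.2.1 x.1.2.2]
    exact h1.negOnePow x.2
  have hnorm : ∀ x : ChordShift n, ‖Z (kClass (shiftedChord n M x))‖ =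
      ‖p x.1.1.2 - p x.1.1.1‖ := fun x => by
    rw [shiftedChord, kClass_shift, map_zsmul, hZ x.1.2.1 x.1.2.2]
    rcases Int.units_eq_one_or x.2.negOnePow with h | h <;> simp [h, norm_sub_rev]
  have : Finite {x : ℕ × ℕ // x.1 < x.2 ∧ x.2 ≤ n} :=
    Set.Finite.subset (Finset.range (n + 1) ×ˢ Finset.range (n + 1)).finite_toSet fun x hx => by
      have h1 := hx.1
      have h2 := hx.2
      simp only [Finset.coe_product, Finset.coe_range, Set.mem_prod, Set.mem_Iio]
      omega
  -- There are finitely many chords, so their inverse lengths are bounded; shifting does not change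
  -- the length.
  obtain ⟨C, hC⟩ := (Set.finite_range
    fun x : {x : ℕ × ℕ // x.1 < x.2 ∧ x.2 ≤ n} => ‖p x.1.2 - p x.1.1‖⁻¹).bddAbove
  have hC' : ∀ x, N ((1 : ℝ) ⊗ₜ[ℤ] kClass (shiftedChord n M x)) ≤
      C * ‖Z (kClass (shiftedChord n M x))‖ := fun x => by
    have h1 := hC ⟨x.1, rfl⟩
    rw [hnorm]
    have h2 : 0 < ‖p x.1.1.2 - p x.1.1.1‖ :=
      norm_pos_iff.2 (hφ.isPhase x.1.2.1 x.1.2.2).ne_zero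
    calc _ ≤ (1 : ℝ) := hN1 x
      _ = ‖p x.1.1.2 - p x.1.1.1‖⁻¹ * ‖p x.1.1.2 - p x.1.1.1‖ := (inv_mul_cancel₀ h2.ne').symm
      _ ≤ _ := by gcongr
  obtain ⟨σ, hσ, hσP⟩ := exists_stabilityCondition_of_phases (shiftedChord n M) ph Z hM.isDSum
    (fun x y f hf => (hM.phase_le_of_hom hφ x y f hf).1) hph
    (fun k x => ⟨⟨x.1, x.2 + k⟩, by simp [ph, add_assoc],
      ⟨((shiftFunctorAdd D x.2 k).app _).symm⟩⟩) N hN C hC'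
  refine ⟨σ, fun E hE => ?_, fun h1 h2 => hσ ▸ hZ h1 h2⟩
  obtain ⟨x, ⟨e⟩⟩ := (hM.isDSum E).of_indecomposable hE
  have hx : phaseProp (shiftedChord n M) ph (ph x) (shiftedChord n M x) :=
    phaseProp_single _ _ _
  have hS := simple_of_phaseProp (X := shiftedChord n M) (ph := ph) (fun x y f hf hxy => by
    obtain rfl := (hM.phase_le_of_hom hφ x y f hf).2 hxy
    exact hM.shiftedChord_isIso_endo x f hf) x (hM.shiftedChord_not_isZero x) hx
  have hE' : phaseProp (shiftedChord n M) ph (ph x) E :=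
    (phaseProp _ ph (ph x)).prop_of_iso e.symm hx
  unfold StabilityCondition.IsStable
  rw [hσP]
  refine ⟨ph x, hE', ?_⟩
  have e' : (⟨E, hE'⟩ : (phaseProp (shiftedChord n M) ph (ph x)).FullSubcategory) ≅
      ⟨shiftedChord n M x, hx⟩ := (phaseProp _ ph (ph x)).isoMk e
  exact Simple.of_iso e'

end IsTypeA

end PhasedFamilies

/-! ### The bijection between orbits and polygons -/

section Polygons

lemma ConvexSeq.div {n : ℕ} {p : ℕ → ℂ} (h : ConvexSeq n p) {c : ℂ} (hc : c ≠ 0) :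
    ConvexSeq n fun k => p k / c := fun i j k hij hjk hk => by
  have h1 : (starRingEnd ℂ (p j / c - p i / c)) * (p k / c - p i / c) =
      ((Complex.normSq c)⁻¹ : ℝ) * ((starRingEnd ℂ (p j - p i)) * (p k - p i)) := by
    have hc' : starRingEnd ℂ c ≠ 0 := by simpa using hc
    push_cast
    rw [← Complex.mul_conj, ← sub_div, ← sub_div, map_div₀]
    field_simp
  rw [h1, Complex.im_ofReal_mul]
  exact mul_pos (inv_pos.2 (Complex.normSq_pos.2 hc)) (h i j k hij hjk hk)

variable {D : Type u} [Category.{v} D] [HasZeroObject D] [HasShift D ℤ] [Preadditive D]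
  [∀ n : ℤ, (shiftFunctor D n).Additive] [Pretriangulated D]

namespace IsTypeA

variable {n : ℕ} {M : ℕ → ℕ → D} (hM : IsTypeA n M)
include hM

lemma charge_ne_zero {σ : StabilityCondition D} (hσ : σ.IsTotallyStable) {a b : ℕ} (hab : a < b)
    (hb : b ≤ n) : σ.Z (kClass (M a b)) ≠ 0 := by
  obtain ⟨φ, hφ, -⟩ := hM.exists_chordPhases hσ
  exact IsPhase.ne_zero (σ.ray _ _ (hφ hab hb) (hM.not_isZero hab hb))

/-- The polygon of a totally stable stability condition. -/
def polygon (hn : 0 < n) (σ : TotallyStable D) : ConvexPoly (n + 1) :=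
  ⟨fun j => chargeVertex M σ.1.Z j / σ.1.Z (kClass (M 0 1)), by simp [chargeVertex], by
    have h1 : ((1 : Fin (n + 1)) : ℕ) = 1 := by
      rw [Fin.val_one', Nat.mod_eq_of_lt (by omega)]
    change chargeVertex M σ.1.Z ((1 : Fin (n + 1)) : ℕ) / _ = 1
    rw [h1]
    exact div_self (hM.charge_ne_zero σ.2 one_pos hn), fun a b c hab hbc => by
      obtain ⟨φ, -, hφ⟩ := hM.exists_chordPhases σ.2
      exact hφ.convexSeq.div (hM.charge_ne_zero σ.2 one_pos hn) a b c hab hbc (by omega)⟩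

/-- Normalizing forgets only the central charge and the phase of `M 0 1`, and these are what the
action of `ℂ` moves. -/
lemma polygon_eq_iff (hn : 0 < n) (σ τ : TotallyStable D) :
    hM.polygon hn σ = hM.polygon hn τ ↔ ∃ s : ℂ, s +ᵥ τ = σ := by
  constructor
  · intro h
    obtain ⟨s, hs⟩ := hM.exists_vadd_eq hn τ.2 σ.2 fun b hb0 hb => by
      have := congrFun (congrArg Subtype.val h) ⟨b, by omega⟩
      simpa [polygon, chargeVertex, hb0.ne'] using this.symm
    exact ⟨s, Subtype.ext hs⟩
  · rintro ⟨s, rfl⟩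
    apply Subtype.ext
    funext j
    have hs : ∀ x, (s +ᵥ τ).1.Z x = τ.1.Z x * Complex.exp (-(Complex.I * Real.pi * s)) :=
      fun _ => rfl
    have h0 := Complex.exp_ne_zero (-(Complex.I * Real.pi * s))
    simp only [polygon, chargeVertex, hs]
    split_ifs
    · simp
    · exact mul_div_mul_right _ _ h0

lemma polygon_surjective (hn : 0 < n) : Function.Surjective (hM.polygon hn) := by
  rintro ⟨P, h0, h1, h⟩
  -- The values beyond `n` are arbitrary: convexity is only imposed up to index `n`.
  let p : ℕ → ℂ := fun k => P ⟨min k n, by omega⟩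
  have hp : ∀ j : Fin (n + 1), p j = P j := fun j =>
    congrArg P (Fin.ext (min_eq_left (by omega)))
  have hp0 : p 0 = 0 := by rw [← h0]; exact hp 0
  have hp1 : p 1 = 1 := by
    rw [← h1, ← hp, Fin.val_one', Nat.mod_eq_of_lt (by omega)]
  have hc : ConvexSeq n p := fun a b c hab hbc hcn =>
    h _ _ _ (Fin.lt_def.2 (by simp only; omega)) (Fin.lt_def.2 (by simp only; omega))
  obtain ⟨σ, hσ, hZ⟩ := hM.exists_stabilityCondition (chordPhases_of_convexSeq hp0 hp1 hc).1
  refine ⟨⟨σ, hσ⟩, Subtype.ext (funext fun j => ?_)⟩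
  simp only [polygon, chargeVertex]
  rw [hZ one_pos hn, hp0, hp1, sub_zero, div_one]
  split_ifs with hj
  · rw [← hp j, hj, hp0]
  · rw [hZ (by omega) (by omega), hp0, sub_zero, hp]

/-- Totally stable stability conditions up to the action of `ℂ` correspond to convex polygons. -/
def polygonEquiv (hn : 0 < n) :
    AddAction.orbitRel.Quotient ℂ (TotallyStable D) ≃ ConvexPoly (n + 1) :=
  Equiv.ofBijective
    (Quotient.lift (hM.polygon hn) fun σ τ h => (hM.polygon_eq_iff hn σ τ).2 h)
    ⟨by
      rintro ⟨σ⟩ ⟨τ⟩ h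
      exact Quotient.sound ((hM.polygon_eq_iff hn σ τ).1 h), fun P => by
      obtain ⟨σ, rfl⟩ := hM.polygon_surjective hn P
      exact ⟨Quotient.mk _ σ, rfl⟩⟩

lemma chargeVertex_eq_mul_polygon (hn : 0 < n) (σ : TotallyStable D) (j : Fin (n + 1)) :
    chargeVertex M σ.1.Z j = σ.1.Z (kClass (M 0 1)) * (hM.polygon hn σ).1 j :=
  (mul_div_cancel₀ _ (hM.charge_ne_zero σ.2 one_pos hn)).symm

/-- The central charges of the indecomposable objects are the oriented sides and diagonals. -/
lemma charge_indecomposable (Z : GrothendieckK D →+ ℂ) :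
    {z : ℂ | ∃ E : D, Indecomposable E ∧ Z (kClass E) = z} =
      {z : ℂ | ∃ a b : Fin (n + 1), a ≠ b ∧ z = chargeVertex M Z b - chargeVertex M Z a} := by
  ext z
  constructor
  · rintro ⟨E, hE, rfl⟩
    obtain ⟨x, ⟨e⟩⟩ := (hM.isDSum E).of_indecomposable hE
    have hx := x.1.2.1
    have hx' := x.1.2.2
    rw [kClass_iso e, shiftedChord, kClass_shift, map_zsmul, hM.charge_eq Z hx hx']
    -- The parity of the shift is the orientation of the chord.
    rcases Int.units_eq_one_or x.2.negOnePow with h | h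
    · exact ⟨⟨x.1.1.1, by omega⟩, ⟨x.1.1.2, by omega⟩, fun h => by
        have := congrArg Fin.val h
        simp only at this
        omega, by simp [h]⟩
    · exact ⟨⟨x.1.1.2, by omega⟩, ⟨x.1.1.1, by omega⟩, fun h => by
        have := congrArg Fin.val h
        simp only at this
        omega, by simp [h]⟩
  · rintro ⟨a, b, hab, rfl⟩
    rcases lt_or_gt_of_ne hab with h | h
    · exact ⟨M a b, hM.indecomposable h (by omega), hM.charge_eq Z h (by omega)⟩
    · refine ⟨_, hM.shiftedChord_indecomposable ⟨⟨(b.val, a.val), h, by omega⟩, 1⟩, ?_⟩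
      rw [shiftedChord, kClass_shift_one, map_neg, hM.charge_eq Z h (by omega), neg_sub]

end IsTypeA

end Polygons

/-! ### The bounded derived category of the linear quiver is of type A -/

section BoundedDerivedCategory

open DerivedCategory DerivedCategory.TStructure LinearA ModA

variable {K : Type u} [Field K] {n : ℕ} [HasDerivedCategory.{w} (ModA K n)]

/-- The element of `Fin n` closest to a natural number. -/
def clampFin (hn : 0 < n) (a : ℕ) : Fin n := ⟨min a (n - 1), by omega⟩

variable (K) in
/-- The module `M_{ij}` attached to the chord joining the vertices `i - 1` and `j`. -/
def chordModule (hn : 0 < n) (a b : ℕ) : DbA K n := MA K (clampFin hn a) (clampFin hn (b - 1))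

lemma clampFin_le (hn : 0 < n) {a b : ℕ} (hab : a < b) :
    clampFin hn a ≤ clampFin hn (b - 1) :=
  Fin.le_def.2 (by simp only [clampFin]; omega)

/-- The triangle of the short exact sequence lifts along the fully faithful inclusion of bounded
objects; only the connecting morphism has to be corrected by the compatibility of the inclusion with
shifts. -/
lemma exists_triangle_chordModule (hn : 0 < n) {a b c : ℕ} (hab : a < b) (hbc : b < c)
    (hc : c ≤ n) : ∃ (f : chordModule K hn a b ⟶ chordModule K hn a c)
      (g : chordModule K hn a c ⟶ chordModule K hn b c)
      (h : chordModule K hn b c ⟶ (chordModule K hn a b)⟦(1 : ℤ)⟧),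
        Triangle.mk f g h ∈ distTriang (DbA K n) := by
  have hS := intervalSES_shortExact (K := K) (clampFin_le hn hab)
    (show (clampFin hn (b - 1)).val + 1 = (clampFin hn b).val by simp only [clampFin]; omega)
    (clampFin_le hn hbc)
  let ι := Bounded.ι (C := ModA K n)
  let δ : ι.obj (chordModule K hn b c) ⟶
    (shiftFunctor (DerivedCategory (ModA K n)) (1 : ℤ)).obj (ι.obj (chordModule K hn a b)) :=
    hS.singleTriangle.mor₃
  let δ' : chordModule K hn b c ⟶ (chordModule K hn a b)⟦(1 : ℤ)⟧ :=
    ι.preimage (δ ≫ (ι.commShiftIso (1 : ℤ)).inv.app (chordModule K hn a b))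
  have hδ : ι.map δ' ≫ (ι.commShiftIso (1 : ℤ)).hom.app (chordModule K hn a b) = δ := by
    rw [Functor.map_preimage, Category.assoc, Iso.inv_hom_id_app]
    exact Category.comp_id _
  refine ⟨⟨hS.singleTriangle.mor₁⟩, ⟨hS.singleTriangle.mor₂⟩, δ', ?_⟩
  refine (ι.map_distinguished_iff _).1 (isomorphic_distinguished _ hS.singleTriangle_distinguished
    _ (Triangle.isoMk _ _ (Iso.refl _) (Iso.refl _) (Iso.refl _) ?_ ?_ ?_))
  · exact (Category.comp_id _).trans (Category.id_comp _).symm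
  · exact (Category.comp_id _).trans (Category.id_comp _).symm
  · refine (congrArg₂ (· ≫ ·) hδ (CategoryTheory.Functor.map_id _ _)).trans ?_
    exact (Category.comp_id _).trans (Category.id_comp _).symm

lemma isTypeA_chordModule (hn : 0 < n) : IsTypeA n (chordModule K hn) where
  triangle := exists_triangle_chordModule hn
  not_isZero {a b} hab hb h := by
    have h1 : IsZero ((singleFunctor (ModA K n) 0).obj
        (intervalModule K (clampFin hn a) (clampFin hn (b - 1)))) :=
      (Bounded.ι (C := ModA K n)).map_isZero h
    exact interval_not_isZero (clampFin_le hn hab)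
      (h1.of_full_of_faithful_of_isZero (singleFunctor (ModA K n) 0) _)
  isIso_endo {a b} hab hb f hf := by
    have : IsIso ((Bounded.ι (C := ModA K n)).map f) :=
      isIso_of_single_endomorphism (clampFin_le hn hab) f.hom fun h =>
        hf ((Bounded.ι (C := ModA K n)).map_injective h)
    exact isIso_of_reflects_iso f (Bounded.ι (C := ModA K n))
  hom_cases {a b a' b'} hab hb hab' hb' k f hf := by
    let ι := Bounded.ι (C := ModA K n)
    have h := interval_hom_cases (clampFin_le hn hab) k
      (ι.map f ≫ (ι.commShiftIso k).hom.app _) fun h => hf (ι.map_injective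
        ((cancel_mono ((ι.commShiftIso k).hom.app (chordModule K hn a' b'))).1
          (h.trans (by rw [Functor.map_zero]; exact Limits.zero_comp.symm))))
    -- The interval with zero-based ends `i, j` is the chord from `i` to `j + 1`, so `i' ≤ j`
    -- becomes `a' < b`, and `i ≤ j' + 1` becomes `a ≤ b'`.
    simp only [Fin.le_def, Fin.lt_def, clampFin] at h
    omega
  isDSum E := by
    let ι := Bounded.ι (C := ModA K n)
    obtain ⟨L, ⟨e⟩⟩ := isDSum_of_bounded E.obj E.property
    let r : ChordShift n → {x : Fin n × Fin n // x.1 ≤ x.2} × ℤ := fun x =>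
      ⟨⟨(clampFin hn x.1.1.1, clampFin hn (x.1.1.2 - 1)), clampFin_le hn x.1.2.1⟩, x.2⟩
    let s : {x : Fin n × Fin n // x.1 ≤ x.2} × ℤ → ChordShift n := fun x =>
      ⟨⟨(x.1.1.1, x.1.1.2 + 1), by have := Fin.le_def.1 x.1.2; simp only; omega⟩, x.2⟩
    have hrs : r ∘ s = id := by
      funext ⟨⟨⟨i, j⟩, hij⟩, k⟩
      simp only [r, s, Function.comp_apply, id, clampFin, Prod.mk.injEq, Subtype.mk.injEq,
        Fin.ext_iff, and_true]
      omega
    obtain ⟨e'⟩ := dsum_map ι (X := shiftedChord n (chordModule K hn)) (Y := shiftedInterval K n)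
      (σ := r) (fun x => ⟨(ι.commShiftIso x.2).app _⟩) (L.map s)
    rw [List.map_map, hrs, List.map_id] at e'
    exact ⟨L.map s, ⟨ι.preimageIso (e ≪≫ e'.symm)⟩⟩
  exists_dim := by
    classical
    refine ⟨fun v => if h : v < n then dimAt (vtx ⟨v, h⟩) else 0, fun {a b} hab hb v hv => ?_⟩
    simp only [hv, dif_pos, chordModule]
    rw [dimAt_MA]
    have : Mem (clampFin hn a) (clampFin hn (b - 1)) (vtx ⟨v, hv⟩) ↔ a ≤ v ∧ v < b := by
      simp only [Mem, pos_vtx, Fin.le_def, clampFin]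
      omega
    simp only [this]

end BoundedDerivedCategory

end

theorem proposition3p5 (K : Type u) [Field K] (n : ℕ) (hn : 0 < n)
    [HasDerivedCategory.{w} (ModA K n)] :
    ∃ 𝔷 : AddAction.orbitRel.Quotient ℂ (TotallyStable (DbA K n)) ≃ ConvexPoly (n + 1),
      ∀ σ : TotallyStable (DbA K n), ∀ P : Fin (n + 1) → ℂ,
        P = (𝔷 (Quotient.mk _ σ)).1 →
        (∀ i j : Fin n, i ≤ j →
          σ.1.Z (kClass (MA K i j)) =
            σ.1.Z (kClass (MA K (⟨0, hn⟩ : Fin n) ⟨0, hn⟩)) * (P j.succ - P i.castSucc)) ∧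
        {z : ℂ | ∃ E : DbA K n, Indecomposable E ∧ σ.1.Z (kClass E) = z} =
          {z : ℂ | ∃ a b : Fin (n + 1), a ≠ b ∧
            z = σ.1.Z (kClass (MA K (⟨0, hn⟩ : Fin n) ⟨0, hn⟩)) * (P b - P a)} := by
  have hM := isTypeA_chordModule (K := K) hn
  refine ⟨hM.polygonEquiv hn, ?_⟩
  rintro σ P rfl
  -- Indices in `Fin n` start at zero, so `i.castSucc` is the vertex `P_{i-1}` and `j.succ` the
  -- vertex `P_j` of the one-based numbering.
  have hchord : ∀ i j : Fin n, MA K i j = chordModule K hn i (j + 1) := fun i j => by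
    have h : ∀ i : Fin n, clampFin hn i = i := fun i => Fin.ext (min_eq_left (by omega))
    rw [chordModule, add_tsub_cancel_right, h, h]
  have hP : ∀ j : Fin (n + 1), chargeVertex (chordModule K hn) σ.1.Z j =
      σ.1.Z (kClass (MA K (⟨0, hn⟩ : Fin n) ⟨0, hn⟩)) *
        (hM.polygonEquiv hn (Quotient.mk _ σ)).1 j := fun j => by
    rw [hchord]
    exact hM.chargeVertex_eq_mul_polygon hn σ j
  constructor
  · intro i j hij
    rw [mul_sub, ← hP, ← hP, hchord i j]
    exact hM.charge_eq _ (Nat.lt_succ_of_le (Fin.le_def.1 hij)) (by omega)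
  · rw [hM.charge_indecomposable σ.1.Z]
    simp only [hP, mul_sub]
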